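/- Let $X$ and $S$ be real analytic manifolds (Hausdorff, countable at infinity). Let $\mathrm{op}(X_{sa})$ be the category of subanalytic open subsets of $X$ (morphisms are inclusions), where a family $\mathcal U$ of subanalytic open subsets of $U$ is a covering of $U$ if for every compact $K\subset X$ there is a finite $\mathcal U_0\subset\mathcal U$ with $K\cap\bigcup_{U'\in\mathcal U_0}U'=K\cap U$. * The site $X_{sa}\times S_{sa}$. Let $\mathcal T$ be the family of products $U\times V$ of relatively compact subanalytic open subsets $U\subset X$, $V\subset S$. The objects of $X_{sa}\times S_{sa}$ are the locally finite (in $X\times S$) unions of elements of $\mathcal T$; a family of subobjects of $W$ is a covering of $W$ if, for every $Q\in\mathcal T$ with $Q\subset W$, its restriction to $Q$ admits a finite subfamily with union $Q$. * The site $X_{sa}\times S$. Its objects are the finite unions of products $U\times V$ with $U\subset X$ subanalytic open and $V\subset S$ open. Its Grothendieck topology is generated by the following coverings: a family covers $U\times V$ if it is refined by a family $\{U_i\times V_j\}_{i\in I,j\in J}$ with $\{U_i\}_{i\in I}$ a covering of $U$ in $X_{sa}$ and $\{V_j\}_{j\in J}$ an open covering of $V$; a family covers a general $W$ if its restriction to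 every $U\times V\subset W$ ($U$ subanalytic open, $V$ open) is a covering. * For a sheaf $F$ of $\mathbb C$-vector spaces on $X_{sa}\times S_{sa}$, the inverse image $a^{-1}F$ is the sheaf on $X_{sa}\times S$ associated with the presheaf $W\mapsto\varinjlim_{W'\supset W}\Gamma(W';F)$, where $W'$ runs over the objects of $X_{sa}\times S_{sa}$ containing $W$. For $W'$ an object of both sites there is a canonical morphism $\Gamma(W';F)\to\Gamma(W';a^{-1}F)$. * For objects $W'\subset W$ of $X_{sa}\times S$, $W'$ is weakly quasi-compact in $W$, written $W'\overset{wc}{\to}W$, if for every covering of $W$ its restriction to $W'$ admits a finite refinement that is a covering of $W'$. Let $F$ be a sheaf of $\mathbb C$-vector spaces on $X_{sa}\times S_{sa}$. (a) For every subanalytic open $U\subset X$ and every open $V\subset S$ there is an isomorphism $$\varprojlim_{V'\subset\subset V}\Gamma(U\times V';F)\ \simeq\ \Gamma(U\times V;a^{-1}F),$$ where $V'$ runs over the subanalytic open subsets of $S$ whose closure is compact and contained in $V$. (b) For every object $W$ of $X_{sa}\times S$ there is an isomorphism $$\varprojlim_{W'\overset{wc}{\to}W}\Gamma(W';F)\ \simeq\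 \Gamma(W;a^{-1}F),$$ where $W'$ runs over the objects of $X_{sa}\times S$ that are also objects of $X_{sa}\times S_{sa}$ and are weakly quasi-compact in $W$. Both isomorphisms are the canonical ones: composed with the restriction to $U\times V'$ (resp. $W'$) they equal the projection of the limit to $\Gamma(U\times V';F)$ (resp. $\Gamma(W';F)$) followed by the canonical morphism to $\Gamma(U\times V';a^{-1}F)$ (resp. $\Gamma(W';a^{-1}F)$). -/

import Mathlib

open CategoryTheory CategoryTheory.Limits Opposite TopologicalSpace
open scoped Manifold ContDiff Topology

universe u v w

namespace RelSub

section Subanalytic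

variable {E H P : Type*} [NormedAddCommGroup E] [NormedSpace ℝ E] [TopologicalSpace H]
  [TopologicalSpace P] [ChartedSpace H P]

/-- The family of subsets of `U` generated by the sets `{f > 0}`, with `f` real analytic on `U`,
under finite unions and complements in `U` (hence also under finite intersections). -/
inductive AnalyticDescribed (I : ModelWithCorners ℝ E H) (U : Set P) : Set P → Prop
  | pos (f : P → ℝ) (hf : ContMDiffOn I 𝓘(ℝ, ℝ) ω f U) : AnalyticDescribed I U {q ∈ U | 0 < f q}
  | union {A B : Set P} (hA : AnalyticDescribed I U A) (hB : AnalyticDescribed I U B) :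
      AnalyticDescribed I U (A ∪ B)
  | compl {A : Set P} (hA : AnalyticDescribed I U A) : AnalyticDescribed I U (U \ A)

/-- A subset of a real analytic manifold is semianalytic if it is, near every point `p` of the
manifold, described by finitely many analytic equations and inequalities. -/
def IsSemianalytic (I : ModelWithCorners ℝ E H) (A : Set P) : Prop :=
  ∀ p : P, ∃ U : Set P, IsOpen U ∧ p ∈ U ∧ AnalyticDescribed I U (A ∩ U)

/-- A subset `A` of a real analytic manifold `X` of dimension `n` is subanalytic if it coincides,
near every point `p` of the manifold, with the projection of a relatively compact semianalytic
subset of `X × ℝᵐ` for some `m`. -/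
def IsSubanalytic (n : ℕ) {X : Type*} [TopologicalSpace X]
    [ChartedSpace (EuclideanSpace ℝ (Fin n)) X] (A : Set X) : Prop :=
  ∀ p : X, ∃ U : Set X, IsOpen U ∧ p ∈ U ∧
    ∃ (m : ℕ) (B : Set (X × EuclideanSpace ℝ (Fin m))),
      IsSemianalytic ((𝓡 n).prod (𝓡 m)) B ∧ IsCompact (closure B) ∧
        A ∩ U = (Prod.fst '' B) ∩ U

theorem AnalyticDescribed.subset {I : ModelWithCorners ℝ E H} {U A : Set P}
    (h : AnalyticDescribed I U A) : A ⊆ U := by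
  induction h with
  | pos f hf => exact fun q hq => hq.1
  | union _ _ h1 h2 => exact Set.union_subset h1 h2
  | compl _ _ => exact Set.sdiff_subset

theorem AnalyticDescribed.inter {I : ModelWithCorners ℝ E H} {U A B : Set P}
    (hA : AnalyticDescribed I U A) (hB : AnalyticDescribed I U B) :
    AnalyticDescribed I U (A ∩ B) := by
  have := (hA.compl.union hB.compl).compl
  have e : U \ (U \ A ∪ U \ B) = A ∩ B := by
    ext q
    have h1 : q ∈ A → q ∈ U := fun h => hA.subset h
    have h2 : q ∈ B → q ∈ U := fun h => hB.subset h
    simp only [Set.mem_sdiff, Set.mem_union, Set.mem_inter_iff]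
    tauto
  rwa [e] at this

theorem AnalyticDescribed.preimage {E' H' P' : Type*} [NormedAddCommGroup E'] [NormedSpace ℝ E']
    [TopologicalSpace H'] [TopologicalSpace P'] [ChartedSpace H' P']
    {I : ModelWithCorners ℝ E H} {I' : ModelWithCorners ℝ E' H'} {g : P' → P}
    (hg : ContMDiff I' I ω g) {U A : Set P} (h : AnalyticDescribed I U A) {U' : Set P'}
    (hU : U' ⊆ g ⁻¹' U) : AnalyticDescribed I' U' (g ⁻¹' A ∩ U') := by
  induction h with
  | pos f hf =>
    have := AnalyticDescribed.pos (I := I') (U := U') (f ∘ g)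
      (hf.comp hg.contMDiffOn hU)
    convert this using 1
    ext q
    have := @hU q
    simp only [Set.mem_inter_iff, Set.mem_preimage, Set.mem_ofPred_eq, Function.comp] at *
    tauto
  | union _ _ h1 h2 =>
    rw [Set.preimage_union, Set.union_inter_distrib_right]
    exact h1.union h2
  | @compl A _ h1 =>
    convert h1.compl using 1
    ext q
    have := @hU q
    simp only [Set.mem_inter_iff, Set.mem_preimage, Set.mem_sdiff] at *
    tauto

theorem IsSemianalytic.inter {I : ModelWithCorners ℝ E H} [IsManifold I ω P] {A B : Set P}
    (hA : IsSemianalytic I A) (hB : IsSemianalytic I B) : IsSemianalytic I (A ∩ B) := by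
  intro p
  obtain ⟨U, hU, hp, h⟩ := hA p
  obtain ⟨U', hU', hp', h'⟩ := hB p
  refine ⟨U ∩ U', hU.inter hU', ⟨hp, hp'⟩, ?_⟩
  have h1 := h.preimage (U' := U ∩ U') (I' := I) contMDiff_id (fun q hq => hq.1)
  have h2 := h'.preimage (U' := U ∩ U') (I' := I) contMDiff_id (fun q hq => hq.2)
  convert h1.inter h2 using 1
  ext q
  simp only [Set.mem_inter_iff, Set.mem_preimage, id]
  tauto

theorem IsSemianalytic.preimage {E' H' P' : Type*} [NormedAddCommGroup E'] [NormedSpace ℝ E']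
    [TopologicalSpace H'] [TopologicalSpace P'] [ChartedSpace H' P']
    {I : ModelWithCorners ℝ E H} {I' : ModelWithCorners ℝ E' H'} {g : P' → P}
    (hg : ContMDiff I' I ω g) {A : Set P} (hA : IsSemianalytic I A) :
    IsSemianalytic I' (g ⁻¹' A) := by
  intro p
  obtain ⟨U, hU, hp, h⟩ := hA (g p)
  refine ⟨g ⁻¹' U, hU.preimage hg.continuous, hp, ?_⟩
  convert h.preimage hg (U' := g ⁻¹' U) subset_rfl using 1
  ext q
  simp

variable {n : ℕ} {X : Type*} [TopologicalSpace X] [ChartedSpace (EuclideanSpace ℝ (Fin n)) X]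
  [IsManifold (𝓡 n) ω X]

theorem IsSubanalytic.inter [T2Space X] {A A' : Set X} (hA : IsSubanalytic n A)
    (hA' : IsSubanalytic n A') : IsSubanalytic n (A ∩ A') := by
  intro p
  obtain ⟨U, hU, hp, m, B, hB, hBc, e⟩ := hA p
  obtain ⟨U', hU', hp', m', B', hB', hBc', e'⟩ := hA' p
  let l : EuclideanSpace ℝ (Fin (m + m')) →L[ℝ] EuclideanSpace ℝ (Fin m) :=
    LinearMap.toContinuousLinearMap
      { toFun := fun z => WithLp.toLp 2 fun i => z (Fin.castAdd m' i)
        map_add' := fun _ _ => rfl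
        map_smul' := fun _ _ => rfl }
  let r : EuclideanSpace ℝ (Fin (m + m')) →L[ℝ] EuclideanSpace ℝ (Fin m') :=
    LinearMap.toContinuousLinearMap
      { toFun := fun z => WithLp.toLp 2 fun i => z (Fin.natAdd m i)
        map_add' := fun _ _ => rfl
        map_smul' := fun _ _ => rfl }
  let a : EuclideanSpace ℝ (Fin m) → EuclideanSpace ℝ (Fin m') →
      EuclideanSpace ℝ (Fin (m + m')) := fun z z' => WithLp.toLp 2 (Fin.append z z')
  have lv : ∀ z i, l z i = z (Fin.castAdd m' i) := fun _ _ => rfl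
  have rv : ∀ z i, r z i = z (Fin.natAdd m i) := fun _ _ => rfl
  have hl : ∀ z z', l (a z z') = z := fun z z' => by ext i; simp [lv, a]
  have hr : ∀ z z', r (a z z') = z' := fun z z' => by ext i; simp [rv, a]
  have ha : ∀ z, a (l z) (r z) = z := fun z => by
    ext i
    refine Fin.addCases (fun i => ?_) (fun i => ?_) i <;> simp [lv, rv, a]
  have hac : Continuous fun z : EuclideanSpace ℝ (Fin m) × EuclideanSpace ℝ (Fin m') =>
      a z.1 z.2 := by
    refine (PiLp.continuous_toLp 2 _).comp (continuous_pi fun i => ?_)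
    refine Fin.addCases (fun i => ?_) (fun i => ?_) i
    · simp only [Fin.append_left]; fun_prop
    · simp only [Fin.append_right]; fun_prop
  have hL : ContMDiff ((𝓡 n).prod (𝓡 (m + m'))) ((𝓡 n).prod (𝓡 m)) ω
      (Prod.map (id : X → X) l) := contMDiff_id.prodMap l.contMDiff
  have hR : ContMDiff ((𝓡 n).prod (𝓡 (m + m'))) ((𝓡 n).prod (𝓡 m')) ω
      (Prod.map (id : X → X) r) := contMDiff_id.prodMap r.contMDiff
  refine ⟨U ∩ U', hU.inter hU', ⟨hp, hp'⟩, m + m',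
    (Prod.map (id : X → X) l) ⁻¹' B ∩ (Prod.map (id : X → X) r) ⁻¹' B',
    (hB.preimage hL).inter (hB'.preimage hR), ?_, ?_⟩
  · have hK := (hBc.prod hBc').image (f := fun y : (X × EuclideanSpace ℝ (Fin m)) ×
        (X × EuclideanSpace ℝ (Fin m')) => (y.1.1, a y.1.2 y.2.2))
        ((continuous_fst.comp continuous_fst).prodMk
          (hac.comp ((continuous_snd.comp continuous_fst).prodMk
            (continuous_snd.comp continuous_snd))))
    refine hK.closure_of_subset ?_
    rintro ⟨x, z⟩ ⟨h1, h2⟩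
    exact ⟨((x, l z), (x, r z)), ⟨subset_closure h1, subset_closure h2⟩, by simp [ha]⟩
  · ext x
    have h1 := Set.ext_iff.1 e x
    have h2 := Set.ext_iff.1 e' x
    have h3 : x ∈ Prod.fst '' ((Prod.map (id : X → X) l) ⁻¹' B ∩
        (Prod.map (id : X → X) r) ⁻¹' B') ↔ x ∈ Prod.fst '' B ∧ x ∈ Prod.fst '' B' := by
      constructor
      · rintro ⟨⟨y, z⟩, ⟨hy, hy'⟩, rfl⟩
        exact ⟨⟨(y, l z), hy, rfl⟩, ⟨(y, r z), hy', rfl⟩⟩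
      · rintro ⟨⟨⟨y, z⟩, hy, hyx⟩, ⟨⟨y', z'⟩, hy', hyx'⟩⟩
        obtain rfl : y = x := hyx
        obtain rfl : y' = y := hyx'
        refine ⟨(y', a z z'), ⟨?_, ?_⟩, rfl⟩
        · simpa only [Set.mem_preimage, Prod.map_apply, hl, id] using hy
        · simpa only [Set.mem_preimage, Prod.map_apply, hr, id] using hy'
    simp only [Set.mem_inter_iff] at h1 h2 ⊢
    rw [h3]
    tauto

/-- Relatively compact subanalytic open sets form a basis of the topology. -/
theorem hasBasis_subanalytic [T2Space X] (x : X) :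
    (𝓝 x).HasBasis (fun V : Set X => IsOpen V ∧ x ∈ V ∧ IsSubanalytic n V ∧
      IsCompact (closure V)) id := by
  refine ⟨fun t => ⟨fun ht => ?_, fun ⟨V, hV, hVt⟩ => Filter.mem_of_superset
    (hV.1.mem_nhds hV.2.1) hVt⟩⟩
  set φ := extChartAt (𝓡 n) x with hφ
  have h1 : φ.target ∩ φ.symm ⁻¹' t ∈ 𝓝 (φ x) := by
    refine Filter.inter_mem (extChartAt_target_mem_nhds x) ?_
    exact (continuousAt_extChartAt_symm x).preimage_mem_nhds
      (by rwa [extChartAt_to_inv])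
  obtain ⟨r, hr, hrt⟩ := Metric.nhds_basis_closedBall.mem_iff.1 h1
  set V : Set X := φ.source ∩ φ ⁻¹' Metric.ball (φ x) r with hVdef
  have hK : IsCompact (φ.symm '' Metric.closedBall (φ x) r) :=
    (isCompact_closedBall _ _).image_of_continuousOn
      ((continuousOn_extChartAt_symm x).mono fun y hy => (hrt hy).1)
  have hVK : V ⊆ φ.symm '' Metric.closedBall (φ x) r := fun y hy =>
    ⟨φ y, Metric.ball_subset_closedBall hy.2, φ.left_inv hy.1⟩
  have hVc : IsCompact (closure V) := hK.closure_of_subset hVK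
  have hVo : IsOpen V := (continuousOn_extChartAt x).isOpen_inter_preimage
    (isOpen_extChartAt_source x) Metric.isOpen_ball
  have hVs : IsSemianalytic (𝓡 n) V := by
    intro p
    by_cases hp : p ∈ φ.source
    · refine ⟨φ.source, isOpen_extChartAt_source x, hp, ?_⟩
      have hf : ContMDiffOn (𝓡 n) 𝓘(ℝ, ℝ) ω (fun q => r ^ 2 - ‖φ q - φ x‖ ^ 2) φ.source := by
        have h2 : ContMDiff (𝓡 n) 𝓘(ℝ, ℝ) ω
            (fun z : EuclideanSpace ℝ (Fin n) => r ^ 2 - ‖z - φ x‖ ^ 2) := by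
          refine ContDiff.contMDiff ?_
          exact contDiff_const.sub ((contDiff_id.sub contDiff_const).norm_sq ℝ)
        exact h2.comp_contMDiffOn (by
          have := contMDiffOn_extChartAt (I := 𝓡 n) (x := x) (n := ω)
          rwa [← extChartAt_source (𝓡 n)] at this)
      convert AnalyticDescribed.pos _ hf using 1
      ext q
      simp only [hVdef, Set.mem_inter_iff, Set.mem_preimage, Metric.mem_ball, Set.mem_ofPred_eq,
        sub_pos, dist_eq_norm]
      rw [sq_lt_sq₀ (norm_nonneg _) hr.le]
      tauto
    · refine ⟨(φ.symm '' Metric.closedBall (φ x) r)ᶜ, hK.isClosed.isOpen_compl, ?_, ?_⟩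
      · rintro ⟨z, hz, rfl⟩
        exact hp (φ.map_target (hrt hz).1)
      · convert AnalyticDescribed.pos (I := 𝓡 n) (fun _ => (0 : ℝ)) contMDiffOn_const using 1
        ext q
        simp only [Set.mem_inter_iff, Set.mem_compl_iff, lt_irrefl, Set.mem_ofPred_eq, and_false,
          iff_false]
        exact fun h => h.2 (hVK h.1)
  refine ⟨V, ⟨hVo, ⟨mem_extChartAt_source x, Metric.mem_ball_self hr⟩, ?_, hVc⟩, ?_⟩
  · intro p
    refine ⟨Set.univ, isOpen_univ, trivial, 0, Prod.fst ⁻¹' V, hVs.preimage contMDiff_fst, ?_, ?_⟩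
    · refine (hVc.prod (isCompact_singleton (x := (0 : EuclideanSpace ℝ (Fin 0))))).closure_of_subset
        fun y hy => ⟨subset_closure hy, Subsingleton.elim _ _⟩
    · rw [Set.image_preimage_eq _ fun y => ⟨(y, 0), rfl⟩]
  · intro y hy
    obtain ⟨z, hz, rfl⟩ := hVK hy
    exact (hrt hz).2

end Subanalytic

section Opens

variable {X : Type u} {S : Type v} [TopologicalSpace X] [TopologicalSpace S]

/-- The open subset `U × V` of `X × S`. -/
def rect (U : Opens X) (V : Opens S) : Opens (X × S) :=
  ⟨(U : Set X) ×ˢ (V : Set S), U.isOpen.prod V.isOpen⟩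

variable (n d : ℕ) (X S)
variable [ChartedSpace (EuclideanSpace ℝ (Fin n)) X] [ChartedSpace (EuclideanSpace ℝ (Fin d)) S]

/-- The family `𝒯` of the products `U × V` of relatively compact subanalytic open subsets. -/
def basicRects : Set (Opens (X × S)) :=
  {Q | ∃ (U : Opens X) (V : Opens S),
    (IsSubanalytic n (U : Set X) ∧ IsCompact (closure (U : Set X))) ∧
    (IsSubanalytic d (V : Set S) ∧ IsCompact (closure (V : Set S))) ∧ Q = rect U V}

/-- `W` is a locally finite union (in `X × S`) of elements of `𝒯`. -/
def IsBisubanalytic (W : Opens (X × S)) : Prop :=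
  ∃ 𝒬 : Set (Opens (X × S)), 𝒬 ⊆ basicRects X S n d ∧
    LocallyFinite (fun Q : 𝒬 => ((Q : Opens (X × S)) : Set (X × S))) ∧ W = sSup 𝒬

/-- `W` is a finite union of products `U × V` with `U` subanalytic open and `V` open. -/
def IsRelSubanalytic (W : Opens (X × S)) : Prop :=
  ∃ 𝒬 : Set (Opens (X × S)), 𝒬.Finite ∧
    (∀ Q ∈ 𝒬, ∃ (U : Opens X) (V : Opens S), IsSubanalytic n (U : Set X) ∧ Q = rect U V) ∧
    W = sSup 𝒬

/-- The category `op(X_sa × S_sa)`: morphisms are inclusions. -/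
abbrev SaSa : Type (max u v) := {W : Opens (X × S) // IsBisubanalytic X S n d W}

/-- The category `op(X_sa × S)`: morphisms are inclusions. -/
abbrev SaTop : Type (max u v) := {W : Opens (X × S) // IsRelSubanalytic X S n W}

variable {n d X S}

/-- `U × V` as an object of `X_sa × S`. -/
def SaTop.rect (U : Opens X) (hU : IsSubanalytic n (U : Set X)) (V : Opens S) : SaTop X S n :=
  ⟨RelSub.rect U V, {RelSub.rect U V}, Set.finite_singleton _, by
    rintro _ rfl; exact ⟨U, V, hU, rfl⟩, by simp⟩

theorem rect_inf (U U' : Opens X) (V V' : Opens S) :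
    rect U V ⊓ rect U' V' = rect (U ⊓ U') (V ⊓ V') := by
  ext x
  simp only [rect, Opens.coe_inf, Opens.coe_mk, Set.mem_inter_iff, Set.mem_prod]
  tauto

theorem basicRects_inf [T2Space X] [T2Space S] [IsManifold (𝓡 n) ω X] [IsManifold (𝓡 d) ω S]
    {Q Q' : Opens (X × S)} (h : Q ∈ basicRects X S n d) (h' : Q' ∈ basicRects X S n d) :
    Q ⊓ Q' ∈ basicRects X S n d := by
  obtain ⟨U, V, hU, hV, rfl⟩ := h
  obtain ⟨U', V', hU', hV', rfl⟩ := h'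
  exact ⟨U ⊓ U', V ⊓ V', ⟨hU.1.inter hU'.1, hU.2.closure_of_subset
    (Set.inter_subset_left.trans subset_closure)⟩, ⟨hV.1.inter hV'.1, hV.2.closure_of_subset
    (Set.inter_subset_left.trans subset_closure)⟩, rect_inf _ _ _ _⟩

theorem isBisubanalytic_iSup {ι : Type*} (f : ι → Opens (X × S))
    (hf : ∀ i, f i ∈ basicRects X S n d) (hl : LocallyFinite fun i => (f i : Set (X × S))) :
    IsBisubanalytic X S n d (⨆ i, f i) := by
  refine ⟨Set.range f, by rintro _ ⟨i, rfl⟩; exact hf i, ?_, rfl⟩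
  refine hl.on_range.comp_injective
    (g := fun Q : Set.range f => ⟨(Q.1 : Set (X × S)), by
      obtain ⟨i, hi⟩ := Q.2; exact ⟨i, by rw [← hi]⟩⟩) ?_
  intro Q Q' h
  exact Subtype.ext (SetLike.coe_injective (Subtype.ext_iff.1 h))

theorem isBisubanalytic_of_mem {Q : Opens (X × S)} (h : Q ∈ basicRects X S n d) :
    IsBisubanalytic X S n d Q := by
  simpa using isBisubanalytic_iSup (fun _ : Unit => Q) (fun _ => h) (locallyFinite_of_finite _)

theorem IsBisubanalytic.inf [T2Space X] [T2Space S] [IsManifold (𝓡 n) ω X]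
    [IsManifold (𝓡 d) ω S] {W W' : Opens (X × S)}
    (h : IsBisubanalytic X S n d W) (h' : IsBisubanalytic X S n d W') :
    IsBisubanalytic X S n d (W ⊓ W') := by
  obtain ⟨𝒬, hQ, hl, rfl⟩ := h
  obtain ⟨𝒬', hQ', hl', rfl⟩ := h'
  have := isBisubanalytic_iSup (n := n) (d := d) (fun p : 𝒬 × 𝒬' => p.1.1 ⊓ p.2.1)
    (fun p => basicRects_inf (hQ p.1.2) (hQ' p.2.2)) (by
      intro x
      obtain ⟨t, ht, hf⟩ := hl x
      obtain ⟨t', ht', hf'⟩ := hl' x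
      refine ⟨t ∩ t', Filter.inter_mem ht ht', (hf.prod hf').subset ?_⟩
      rintro p ⟨y, hy, hy'⟩
      exact ⟨⟨y, hy.1, hy'.1⟩, ⟨y, hy.2, hy'.2⟩⟩)
  convert this using 1
  ext x
  simp only [Opens.coe_inf, Opens.coe_sSup, Opens.coe_iSup, Set.mem_inter_iff, Set.mem_iUnion]
  constructor
  · rintro ⟨⟨Q, hq, h⟩, ⟨Q', hq', h'⟩⟩
    exact ⟨(⟨Q, hq⟩, ⟨Q', hq'⟩), h, h'⟩
  · rintro ⟨p, h, h'⟩
    exact ⟨⟨p.1, p.1.2, h⟩, ⟨p.2, p.2.2, h'⟩⟩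

/-- Relatively compact subanalytic open sets form a locally finite covering of a manifold. -/
theorem exists_locallyFinite_subanalytic (X : Type u) [TopologicalSpace X]
    [ChartedSpace (EuclideanSpace ℝ (Fin n)) X]
    [T2Space X] [SecondCountableTopology X] [IsManifold (𝓡 n) ω X] :
    ∃ (α : Type u) (f : α → Opens X), (∀ a, IsSubanalytic n (f a : Set X) ∧
      IsCompact (closure (f a : Set X))) ∧ ⨆ a, f a = ⊤ ∧
      LocallyFinite fun a => (f a : Set X) := by
  have : LocallyCompactSpace X := ChartedSpace.locallyCompactSpace (EuclideanSpace ℝ (Fin n)) X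
  obtain ⟨α, c, r, h1, h2, h3⟩ := refinement_of_locallyCompact_sigmaCompact_of_nhds_basis
    (fun x : X => hasBasis_subanalytic (n := n) x)
  exact ⟨α, fun a => ⟨r a, (h1 a).1⟩, fun a => ⟨(h1 a).2.2.1, (h1 a).2.2.2⟩,
    Opens.ext (by simpa using h2), h3⟩

/-- `U × V'`, with `U` and `V'` subanalytic and `V'` relatively compact, as an object of
`X_sa × S_sa`. -/
def SaSa.rect [T2Space X] [T2Space S] [SecondCountableTopology X] [IsManifold (𝓡 n) ω X]
    (U : Opens X) (hU : IsSubanalytic n (U : Set X))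
    (V' : Opens S) (hV' : IsSubanalytic d (V' : Set S)) (hV'c : IsCompact (closure (V' : Set S))) :
    SaSa X S n d :=
  ⟨RelSub.rect U V', by
    obtain ⟨α, f, hf, htop, hl⟩ := exists_locallyFinite_subanalytic (n := n) X
    have := isBisubanalytic_iSup (n := n) (d := d) (fun a => RelSub.rect (U ⊓ f a) V')
      (fun a => ⟨U ⊓ f a, V', ⟨hU.inter (hf a).1, (hf a).2.closure_of_subset
        (Set.inter_subset_right.trans subset_closure)⟩, ⟨hV', hV'c⟩, rfl⟩)
      ((hl.subset fun a => Set.inter_subset_right).prod_right _)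
    convert this using 1
    ext x
    have hx : x.1 ∈ ⨆ a, f a := by rw [htop]; trivial
    rw [Opens.mem_iSup] at hx
    obtain ⟨a, ha⟩ := hx
    simp only [RelSub.rect, Opens.coe_iSup, Opens.coe_mk, Opens.coe_inf, Set.mem_iUnion,
      Set.mem_prod, Set.mem_inter_iff]
    exact ⟨fun h => ⟨a, ⟨h.1, ha⟩, h.2⟩, fun ⟨_, h, h'⟩ => ⟨h.1, h'⟩⟩⟩

end Opens

section Topologies

variable {n d : ℕ} {X : Type u} {S : Type v} [TopologicalSpace X] [TopologicalSpace S]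
  [ChartedSpace (EuclideanSpace ℝ (Fin n)) X] [ChartedSpace (EuclideanSpace ℝ (Fin d)) S]

/-- The coverings of `U` in the subanalytic site `X_sa`: families `𝒰` of subanalytic open subsets
of `U` such that every compact `K` admits a finite subfamily `𝒰₀` with `K ∩ ⋃ 𝒰₀ = K ∩ U`. -/
def IsSaCovering (n : ℕ) {X : Type u} [TopologicalSpace X]
    [ChartedSpace (EuclideanSpace ℝ (Fin n)) X] (U : Opens X) (𝒰 : Set (Opens X)) : Prop :=
  (∀ U' ∈ 𝒰, IsSubanalytic n (U' : Set X) ∧ U' ≤ U) ∧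
  ∀ K : Set X, IsCompact K → ∃ 𝒰₀ ⊆ 𝒰, 𝒰₀.Finite ∧
    K ∩ ((sSup 𝒰₀ : Opens X) : Set X) = K ∩ (U : Set X)

variable (n d X S)

/-- The Grothendieck topology of `X_sa × S_sa`: a sieve on `W` is covering if for any `Q ∈ 𝒯`
contained in `W`, finitely many of its members cover `Q`. -/
def saSaTopology [T2Space X] [T2Space S] [IsManifold (𝓡 n) ω X] [IsManifold (𝓡 d) ω S] :
    GrothendieckTopology (SaSa X S n d) where
  sieves W := {R | ∀ Q ∈ basicRects X S n d, Q ≤ W.1 → ∃ t : Set (SaSa X S n d), t.Finite ∧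
    (∀ Z ∈ t, ∃ h : Z ≤ W, R.arrows (homOfLE h)) ∧ (Q : Set (X × S)) ⊆ ⋃ Z ∈ t, (Z.1 : Set (X × S))}
  top_mem' W Q _ hQW := ⟨{W}, Set.finite_singleton _, by rintro _ rfl; exact ⟨le_rfl, trivial⟩,
    by simpa using hQW⟩
  pullback_stable' := by
    intro W W' R f hR Q hQ hQW
    obtain ⟨t, ht, htR, hc⟩ := hR Q hQ (hQW.trans (leOfHom f))
    let g : SaSa X S n d → SaSa X S n d := fun Z => ⟨Z.1 ⊓ W'.1, Z.2.inf W'.2⟩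
    refine ⟨g '' t, ht.image g, ?_, ?_⟩
    · rintro _ ⟨Z, hZ, rfl⟩
      obtain ⟨h, hR'⟩ := htR Z hZ
      exact ⟨inf_le_right (a := Z.1), R.downward_closed hR' (homOfLE (inf_le_left (a := Z.1)))⟩
    · intro x hx
      obtain ⟨Z, hZ, hxZ⟩ := Set.mem_iUnion₂.1 (hc hx)
      exact Set.mem_iUnion₂.2 ⟨g Z, ⟨Z, hZ, rfl⟩, hxZ, hQW hx⟩
  transitive' := by
    intro W R hR R' hR' Q hQ hQW
    obtain ⟨t, ht, htR, hc⟩ := hR Q hQ hQW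
    have hQc : IsCompact (closure (Q : Set (X × S))) := by
      obtain ⟨U, V, hU, hV, rfl⟩ := hQ
      simpa [rect, closure_prod_eq] using hU.2.prod hV.2
    have key : ∀ Z ∈ t, ∃ t' : Set (SaSa X S n d), t'.Finite ∧
        (∀ Y ∈ t', ∃ h : Y ≤ W, R'.arrows (homOfLE h)) ∧
        (Q : Set (X × S)) ∩ Z.1 ⊆ ⋃ Y ∈ t', (Y.1 : Set (X × S)) := by
      intro Z hZ
      obtain ⟨h, hRZ⟩ := htR Z hZ
      obtain ⟨𝒬, h𝒬, hl, hZ𝒬⟩ := Z.2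
      have hfin := hl.finite_nonempty_inter_compact hQc
      have : ∀ P : 𝒬, ∃ t' : Set (SaSa X S n d), t'.Finite ∧
          (∀ Y ∈ t', ∃ h : Y ≤ W, R'.arrows (homOfLE h)) ∧
          ((P : Opens (X × S)) : Set (X × S)) ⊆ ⋃ Y ∈ t', (Y.1 : Set (X × S)) := by
        intro P
        obtain ⟨t', h1, h2, h3⟩ := hR' hRZ P.1 (h𝒬 P.2) (hZ𝒬 ▸ le_sSup P.2)
        exact ⟨t', h1, fun Y hY => by
          obtain ⟨h', hh⟩ := h2 Y hY
          exact ⟨h'.trans h, hh⟩, h3⟩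
      choose T hT1 hT2 hT3 using this
      refine ⟨⋃ P ∈ {P : 𝒬 | ((P.1 : Set (X × S)) ∩ closure (Q : Set (X × S))).Nonempty}, T P,
        hfin.biUnion fun P _ => hT1 P, ?_, ?_⟩
      · intro Y hY
        obtain ⟨P, _, hP⟩ := Set.mem_iUnion₂.1 hY
        exact hT2 P Y hP
      · rintro x ⟨hxQ, hxZ⟩
        rw [hZ𝒬] at hxZ
        obtain ⟨P, hP, hxP⟩ := Opens.mem_sSup.1 hxZ
        obtain ⟨Y, hY, hxY⟩ := Set.mem_iUnion₂.1 (hT3 ⟨P, hP⟩ hxP)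
        exact Set.mem_iUnion₂.2 ⟨Y, Set.mem_iUnion₂.2 ⟨⟨P, hP⟩, ⟨x, hxP, subset_closure hxQ⟩, hY⟩,
          hxY⟩
    choose! T hT1 hT2 hT3 using key
    refine ⟨⋃ Z ∈ t, T Z, ht.biUnion hT1, ?_, ?_⟩
    · intro Y hY
      obtain ⟨Z, hZ, h⟩ := Set.mem_iUnion₂.1 hY
      exact hT2 Z hZ Y h
    · intro x hx
      obtain ⟨Z, hZ, hxZ⟩ := Set.mem_iUnion₂.1 (hc hx)
      obtain ⟨Y, hY, hxY⟩ := Set.mem_iUnion₂.1 (hT3 Z hZ ⟨hx, hxZ⟩)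
      exact Set.mem_iUnion₂.2 ⟨Y, Set.mem_iUnion₂.2 ⟨Z, hZ, hY⟩, hxY⟩

variable {n X S} in
/-- The sieve on `U × V` generated by the products `U' × V'`, `U' ∈ 𝒰`, `V' ∈ 𝒱`. -/
def productSieve (U : Opens X) (hU : IsSubanalytic n (U : Set X)) (V : Opens S)
    (𝒰 : Set (Opens X)) (h𝒰 : IsSaCovering n U 𝒰) (𝒱 : Set (Opens S)) :
    Sieve (SaTop.rect U hU V) :=
  Sieve.ofObjects (fun p : 𝒰 × 𝒱 => SaTop.rect p.1.1 (h𝒰.1 _ p.1.2).1 p.2.1) _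

/-- The Grothendieck topology of `X_sa × S`, generated by the following coverings:
a family covers `U × V` if it is refined by some `{U' × V'}` with `{U'}` a covering of `U` in `X_sa`
and `{V'}` an open covering of `V`; a family covers `W` if its restriction to every
`U × V` contained in `W` is a covering. -/
def saTopTopology : GrothendieckTopology (SaTop X S n) :=
  sInf {J | (∀ (U : Opens X) (hU : IsSubanalytic n (U : Set X)) (V : Opens S)
      (𝒰 : Set (Opens X)) (h𝒰 : IsSaCovering n U 𝒰) (𝒱 : Set (Opens S)), sSup 𝒱 = V →
        productSieve U hU V 𝒰 h𝒰 𝒱 ∈ J (SaTop.rect U hU V)) ∧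
    (∀ (W : SaTop X S n) (R : Sieve W),
      (∀ (U : Opens X) (hU : IsSubanalytic n (U : Set X)) (V : Opens S)
        (h : SaTop.rect U hU V ≤ W), R.pullback (homOfLE h) ∈ J (SaTop.rect U hU V)) → R ∈ J W)}

end Topologies

section Explicit

variable {n : ℕ} {X : Type u} {S : Type v} [TopologicalSpace X] [TopologicalSpace S]
  [ChartedSpace (EuclideanSpace ℝ (Fin n)) X]

variable (n X S) in
/-- Another description of `saTopTopology`, see `saTopTopology_eq`: a sieve on `W` is covering if for
any `U × V` contained in `W`, with `U` relatively compact, and any `s ∈ V`, there are an open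
neighbourhood `N` of `s` in `V` and a finite covering of `U` by subanalytic open sets `U'` such that
the sets `U' × N` belong to the sieve. -/
def localTopology [T2Space X] : GrothendieckTopology (SaTop X S n) where
  sieves W := {R | ∀ (U : Opens X), IsSubanalytic n (U : Set X) → IsCompact (closure (U : Set X)) →
    ∀ (V : Opens S), rect U V ≤ W.1 → ∀ s ∈ V, ∃ N : Opens S, s ∈ N ∧ N ≤ V ∧
      ∃ 𝒰 : Set (Opens X), 𝒰.Finite ∧ U = sSup 𝒰 ∧ ∀ U' ∈ 𝒰,
        ∃ (hU' : IsSubanalytic n (U' : Set X)) (h : SaTop.rect U' hU' N ≤ W),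
          R.arrows (homOfLE h)}
  top_mem' W U hU _ V hW s hs := ⟨V, hs, le_rfl, {U}, Set.finite_singleton _, by simp, by
    rintro _ rfl; exact ⟨hU, hW, trivial⟩⟩
  pullback_stable' := by
    intro W W' R f hR U hU hUc V hW s hs
    obtain ⟨N, hsN, hNV, 𝒰, hf, rfl, hR'⟩ := hR U hU hUc V (hW.trans (leOfHom f)) s hs
    refine ⟨N, hsN, hNV, 𝒰, hf, rfl, fun U' hU'𝒰 => ?_⟩
    obtain ⟨hU', h, hh⟩ := hR' U' hU'𝒰
    exact ⟨hU', fun y hy => hW (Set.prod_mono (le_sSup hU'𝒰 : U' ≤ sSup 𝒰) hNV hy), hh⟩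
  transitive' := by
    intro W R hR R' hR' U hU hUc V hW s hs
    obtain ⟨N, hsN, hNV, 𝒰, hf, rfl, hRN⟩ := hR U hU hUc V hW s hs
    have : ∀ U' ∈ 𝒰, ∃ N' : Opens S, s ∈ N' ∧ N' ≤ N ∧
      ∃ 𝒰' : Set (Opens X), 𝒰'.Finite ∧ U' = sSup 𝒰' ∧ ∀ U'' ∈ 𝒰',
        ∃ (hU'' : IsSubanalytic n (U'' : Set X)) (h : SaTop.rect U'' hU'' N' ≤ W),
          R'.arrows (homOfLE h) := by
      intro U' hU'𝒰
      obtain ⟨hU', h, hh⟩ := hRN U' hU'𝒰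
      obtain ⟨N', h1, h2, 𝒰', h3, h4, h5⟩ := hR' hh U' hU'
        (hUc.closure_of_subset (fun y hy => subset_closure ((le_sSup hU'𝒰 : U' ≤ sSup 𝒰) hy))) N le_rfl s hsN
      refine ⟨N', h1, h2, 𝒰', h3, h4, fun U'' hU'' => ?_⟩
      obtain ⟨a, b, c⟩ := h5 U'' hU''
      exact ⟨a, b.trans h, c⟩
    choose! N' h1 h2 T h3 h4 h5 using this
    refine ⟨⟨(N : Set S) ∩ ⋂ U' ∈ 𝒰, (N' U' : Set S), N.isOpen.inter
      (hf.isOpen_biInter fun U' _ => (N' U').isOpen)⟩, ⟨hsN, Set.mem_iInter₂.2 h1⟩,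
      fun y hy => hNV hy.1, ⋃ U' ∈ 𝒰, T U', hf.biUnion h3, ?_, ?_⟩
    · apply le_antisymm
      · refine sSup_le fun U' hU' => ?_
        rw [h4 U' hU']
        exact sSup_le_sSup (Set.subset_biUnion_of_mem hU')
      · refine sSup_le fun U'' hU'' => ?_
        obtain ⟨U', hU', hT⟩ := Set.mem_iUnion₂.1 hU''
        exact (le_sSup hT).trans ((h4 U' hU').symm.le.trans (le_sSup hU'))
    · intro U'' hU''
      obtain ⟨U', hU', hT⟩ := Set.mem_iUnion₂.1 hU''
      obtain ⟨a, b, c⟩ := h5 U' hU' U'' hT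
      have hle : SaTop.rect U'' a ⟨(N : Set S) ∩ ⋂ U' ∈ 𝒰, (N' U' : Set S), N.isOpen.inter
          (hf.isOpen_biInter fun U' _ => (N' U').isOpen)⟩ ≤ SaTop.rect U'' a (N' U') :=
        Set.prod_mono_right fun y hy => Set.mem_iInter₂.1 hy.2 U' hU'
      exact ⟨a, hle.trans b, R'.downward_closed c (homOfLE hle)⟩

theorem saTopTopology_eq [T2Space X] [IsManifold (𝓡 n) ω X] :
    saTopTopology n X S = localTopology n X S := by
  apply le_antisymm
  · refine sInf_le ⟨?_, ?_⟩
    · intro U hU V 𝒰 h𝒰 𝒱 h𝒱 U₁ hU₁ hU₁c V₁ hW s hs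
      rcases (U₁ : Set X).eq_empty_or_nonempty with he | ⟨x, hx⟩
      · exact ⟨V₁, hs, le_rfl, ∅, Set.finite_empty, by ext x; simp [he], by simp⟩
      have hle : U₁ ≤ U := fun y hy => (hW (show (y, s) ∈ rect U₁ V₁ from ⟨hy, hs⟩)).1
      have hsV : s ∈ V := (hW (show (x, s) ∈ rect U₁ V₁ from ⟨hx, hs⟩)).2
      rw [← h𝒱] at hsV
      obtain ⟨V', hV', hsV'⟩ := Opens.mem_sSup.1 hsV
      obtain ⟨𝒰₀, hsub, hfin, hK⟩ := h𝒰.2 _ hU₁c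
      refine ⟨V' ⊓ V₁, ⟨hsV', hs⟩, inf_le_right, (fun U' => U₁ ⊓ U') '' 𝒰₀, hfin.image _, ?_, ?_⟩
      · ext y
        have := Set.ext_iff.1 hK y
        simp only [Set.mem_inter_iff, Opens.coe_sSup, Set.mem_iUnion, SetLike.mem_coe,
          exists_prop, Set.mem_image, exists_exists_and_eq_and, Opens.mem_inf] at this ⊢
        constructor
        · intro hy
          obtain ⟨_, U', h1, h2⟩ := this.2 ⟨subset_closure hy, hle hy⟩
          exact ⟨U', h1, hy, h2⟩
        · rintro ⟨U', _, h, _⟩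
          exact h
      · rintro _ ⟨U', hU', rfl⟩
        refine ⟨hU₁.inter (h𝒰.1 U' (hsub hU')).1,
          fun y hy => hW (Set.prod_mono Set.inter_subset_left Set.inter_subset_right hy), ?_⟩
        exact ⟨(⟨U', hsub hU'⟩, ⟨V', hV'⟩),
          ⟨homOfLE (Set.prod_mono Set.inter_subset_right Set.inter_subset_left)⟩⟩
    · intro W R hR U hU hUc V hW s hs
      obtain ⟨N, h1, h2, 𝒰, h3, h4, h5⟩ := hR U hU V hW U hU hUc V le_rfl s hs
      refine ⟨N, h1, h2, 𝒰, h3, h4, fun U' hU' => ?_⟩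
      obtain ⟨a, b, c⟩ := h5 U' hU'
      exact ⟨a, b.trans hW, c⟩
  · refine le_sInf ?_
    rintro J ⟨hJ1, hJ2⟩ W R hR
    refine hJ2 W R fun U hU V hUV => ?_
    have hcov : IsSaCovering n U {U' | (IsSubanalytic n (U' : Set X) ∧ U' ≤ U) ∧
        IsCompact (closure (U' : Set X))} := by
      refine ⟨fun U' h => h.1, fun K hK => ?_⟩
      choose B hB using fun x : X => (hasBasis_subanalytic (n := n) x).ex_mem
      obtain ⟨t, _, htK⟩ := hK.elim_nhds_subcover B fun x _ => (hB x).1.mem_nhds (hB x).2.1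
      refine ⟨(fun x => U ⊓ ⟨B x, (hB x).1⟩) '' t, ?_, t.finite_toSet.image _, ?_⟩
      · rintro _ ⟨x, _, rfl⟩
        exact ⟨⟨hU.inter (hB x).2.2.1, inf_le_left⟩, (hB x).2.2.2.closure_of_subset
          (Set.inter_subset_right.trans subset_closure)⟩
      · ext y
        simp only [Set.mem_inter_iff, Opens.coe_sSup, Set.mem_iUnion, SetLike.mem_coe,
          exists_prop, Set.mem_image, exists_exists_and_eq_and, Opens.mem_inf]
        constructor
        · rintro ⟨hy, x, _, h, _⟩
          exact ⟨hy, h⟩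
        · rintro ⟨hy, h⟩
          obtain ⟨x, hx, hyx⟩ := Set.mem_iUnion₂.1 (htK hy)
          exact ⟨hy, x, hx, h, hyx⟩
    refine J.transitive (hJ1 U hU V _ hcov {V} sSup_singleton) _ ?_
    rintro Z f ⟨⟨⟨U', ⟨hU', hU'U⟩, hU'c⟩, ⟨V', hV'⟩⟩, ⟨g⟩⟩
    obtain rfl : V' = V := hV'
    have hle : SaTop.rect U' hU' V' ≤ W := le_trans (Set.prod_mono_left hU'U) hUV
    suffices h : R.pullback (homOfLE hle) ∈ J _ by
      have := J.pullback_stable g h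
      rw [← Sieve.pullback_comp] at this ⊢
      exact this
    have hone : IsSaCovering n U' {U'} :=
      ⟨by rintro _ rfl; exact ⟨hU', le_rfl⟩, fun K _ => ⟨{U'}, le_rfl, Set.finite_singleton _,
        by simp⟩⟩
    refine J.transitive (hJ1 U' hU' V' _ hone {N | N ≤ V' ∧
      ∃ 𝒰 : Set (Opens X), 𝒰.Finite ∧ U' = sSup 𝒰 ∧ ∀ U'' ∈ 𝒰,
        ∃ (hU' : IsSubanalytic n (U'' : Set X)) (h : SaTop.rect U'' hU' N ≤ W),
          R.arrows (homOfLE h)} ?_) _ ?_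
    · apply le_antisymm
      · exact sSup_le fun N hN => hN.1
      · intro s hs
        obtain ⟨N, h1, h2, h3⟩ := hR U' hU' hU'c V' hle s hs
        exact Opens.mem_sSup.2 ⟨N, ⟨h2, h3⟩, h1⟩
    rintro Z' f' ⟨⟨⟨U₁, hU₁⟩, ⟨N, hNV, 𝒰, hfin, he, hR'⟩⟩, ⟨g'⟩⟩
    obtain rfl : U₁ = U' := hU₁
    have hle' : SaTop.rect U₁ hU' N ≤ W := le_trans (Set.prod_mono_right hNV) hle
    suffices h : R.pullback (homOfLE hle') ∈ J _ by
      have := J.pullback_stable g' h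
      rw [← Sieve.pullback_comp] at this ⊢
      exact this
    have hcov' : IsSaCovering n U₁ 𝒰 := ⟨fun U'' h => ⟨(hR' U'' h).1, he ▸ le_sSup h⟩,
      fun K _ => ⟨𝒰, le_rfl, hfin, by rw [he]⟩⟩
    refine J.superset_covering ?_ (hJ1 U₁ hU' N 𝒰 hcov' {N} (by simp))
    rintro Y k ⟨⟨⟨U'', hU''⟩, ⟨_, rfl⟩⟩, ⟨l⟩⟩
    obtain ⟨a, b, c⟩ := hR' U'' hU''
    exact R.downward_closed c l

end Explicit

/-- On a site whose objects are ordered by inclusion: `V ⊆ U` is weakly quasi-compact in `U` if the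
restriction to `V` of every covering of `U` admits a finite refinement which covers `V`. -/
def IsWeaklyQuasiCompact {C : Type w} [Preorder C] (J : GrothendieckTopology C) {V U : C}
    (h : V ≤ U) : Prop :=
  ∀ R ∈ J U, ∃ t : Set C, t.Finite ∧
    (∀ Z ∈ t, ∃ hZ : Z ≤ V, (R.pullback (homOfLE h)).arrows (homOfLE hZ)) ∧
    Sieve.ofObjects (fun Z : t => (Z : C)) V ∈ J V

instance forget_preservesFilteredColimits :
    PreservesFilteredColimitsOfSize.{w, w} (forget (ModuleCat.{w} ℂ)) :=
  comp_preservesFilteredColimits (forget₂ (ModuleCat.{w} ℂ) AddCommGrpCat.{w})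
    (forget AddCommGrpCat.{w})

noncomputable section InverseImage

variable {n d : ℕ} {X : Type u} {S : Type v} [TopologicalSpace X] [TopologicalSpace S]
  [ChartedSpace (EuclideanSpace ℝ (Fin n)) X] [ChartedSpace (EuclideanSpace ℝ (Fin d)) S]

variable (n d X S) in
/-- The inclusion of `op(X_sa × S_sa)` into the open subsets of `X × S`. -/
def saSaInclusion : SaSa X S n d ⥤ Opens (X × S) :=
  Monotone.functor (f := Subtype.val) fun _ _ h => h

variable (n X S) in
/-- The inclusion of `op(X_sa × S)` into the open subsets of `X × S`. -/
def saTopInclusion : SaTop X S n ⥤ Opens (X × S) :=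
  Monotone.functor (f := Subtype.val) fun _ _ h => h

variable [T2Space X] [T2Space S] [IsManifold (𝓡 n) ω X] [IsManifold (𝓡 d) ω S]

/-- Sheaves of complex vector spaces on `X_sa × S_sa`. -/
abbrev SaSaSheaf (n d : ℕ) (X : Type u) (S : Type v) [TopologicalSpace X] [TopologicalSpace S]
    [ChartedSpace (EuclideanSpace ℝ (Fin n)) X] [ChartedSpace (EuclideanSpace ℝ (Fin d)) S]
    [T2Space X] [T2Space S] [IsManifold (𝓡 n) ω X] [IsManifold (𝓡 d) ω S] :=
  Sheaf (saSaTopology n d X S) (ModuleCat.{max u v} ℂ)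

/-- The presheaf `W ↦ colim F(W')` on `X_sa × S`, where `W'` runs over the objects of
`X_sa × S_sa` containing `W`. -/
def preInverseImage (F : SaSaSheaf n d X S) : (SaTop X S n)ᵒᵖ ⥤ ModuleCat.{max u v} ℂ :=
  (saTopInclusion n X S).op ⋙ (saSaInclusion n d X S).op.lan.obj F.obj

/-- The inverse image `a⁻¹F` on `X_sa × S` of a sheaf `F` on `X_sa × S_sa`: the sheaf associated
with `preInverseImage F`. -/
def inverseImage (F : SaSaSheaf n d X S) :
    Sheaf (saTopTopology n X S) (ModuleCat.{max u v} ℂ) :=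
  (presheafToSheaf (saTopTopology n X S) (ModuleCat.{max u v} ℂ)).obj (preInverseImage F)

/-- The canonical morphism `Γ(W; F) → Γ(W; a⁻¹F)`, for `W` an object of both sites. -/
def toInverseImage (F : SaSaSheaf n d X S) (W : Opens (X × S)) (h : IsBisubanalytic X S n d W)
    (h' : IsRelSubanalytic X S n W) :
    F.obj.obj (op ⟨W, h⟩) ⟶ (inverseImage F).obj.obj (op ⟨W, h'⟩) :=
  ((saSaInclusion n d X S).op.lanUnit.app F.obj).app (op ⟨W, h⟩) ≫
    (toSheafify (saTopTopology n X S) (preInverseImage F)).app (op ⟨W, h'⟩)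

/-- The subanalytic open subsets `V' ⊂⊂ V`. -/
abbrev RelCompactSubanalytic (d : ℕ) {S : Type v} [TopologicalSpace S]
    [ChartedSpace (EuclideanSpace ℝ (Fin d)) S] (V : Opens S) : Type v :=
  {V' : Opens S // IsSubanalytic d (V' : Set S) ∧ IsCompact (closure (V' : Set S)) ∧
    closure (V' : Set S) ⊆ V}

/-- The projective system `V' ↦ Γ(U × V'; F)`, `V' ⊂⊂ V` subanalytic. -/
def rectSystem [SecondCountableTopology X] (F : SaSaSheaf n d X S) (U : Opens X)
    (hU : IsSubanalytic n (U : Set X)) (V : Opens S) :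
    (RelCompactSubanalytic d V)ᵒᵖ ⥤ ModuleCat.{max u v} ℂ :=
  (Monotone.functor (f := fun V' : RelCompactSubanalytic d V =>
    SaSa.rect (n := n) U hU V'.1 V'.2.1 V'.2.2.1) fun _ _ h => Set.prod_mono_right h).op ⋙ F.obj

variable (d) in
/-- The objects `W'` of `X_sa × S_sa` that are weakly quasi-compact in `W` (on `X_sa × S`). -/
abbrev WeaklyQuasiCompactIn (W : SaTop X S n) : Type (max u v) :=
  {W' : SaTop X S n // IsBisubanalytic X S n d W'.1 ∧
    ∃ h : W' ≤ W, IsWeaklyQuasiCompact (saTopTopology n X S) h}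

/-- The projective system `W' ↦ Γ(W'; F)`, `W'` weakly quasi-compact in `W`. -/
def wqcSystem (F : SaSaSheaf n d X S) (W : SaTop X S n) :
    (WeaklyQuasiCompactIn d W)ᵒᵖ ⥤ ModuleCat.{max u v} ℂ :=
  (Monotone.functor (f := fun W' : WeaklyQuasiCompactIn d W =>
    (⟨W'.1.1, W'.2.1⟩ : SaSa X S n d)) fun _ _ h => h).op ⋙ F.obj

end InverseImage

end RelSub

/-!
Call `Y` fibrewise inner in `W` if the closure in `S` of each slice of `Y` over `X` lies in the
slice of `W`. Objects of `X_sa × S` are finite unions of rectangles, so whether a family covers `W`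
can be tested on the sets `U × {s}` with `U` relatively compact. By compactness of the closures of
the sets `V` in the relatively compact rectangles `U × V`, a covering of `W` in `X_sa × S` is
refined by a covering in `X_sa × S_sa` of any `Y` fibrewise inner in `W`, whose members are again
fibrewise inner in members of the given covering.

A section `α` of `a⁻¹F` on `W` is induced on a covering by sections of `F`, and two sections of `F`
inducing the same section of `a⁻¹F` on `Z` agree on every object fibrewise inner in `Z`. So the
local representatives of `α` glue to a unique section of `F` on each `Y` fibrewise inner in `W`, and
the limit of `F` along any family of fibrewise inner objects stable under intersection and covering
`W` is `Γ(W; a⁻¹F)`. The sets `U × V'` with `V' ⊂⊂ V` form such a family, and so do the objects that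
are weakly quasi-compact in `W`: such an object lies in a finite union of fibrewise inner ones,
because these cover `W`, and conversely a relatively compact rectangle that is fibrewise inner in
`W` is weakly quasi-compact in it.
-/

namespace RelSub

section FiberwiseInner

variable {X : Type u} {S : Type v} [TopologicalSpace S]

/-- `Y` is fibrewise inner in `W`: for every `x`, the closure in `S` of the slice of `Y` at `x` is
contained in the slice of `W`. For `U ≠ ∅`, the set `U × V'` is fibrewise inner in `U × V` if and
only if the closure of `V'` is contained in `V`. -/
def IsFiberwiseInner (Y W : Set (X × S)) : Prop :=
  ∀ x, closure (Prod.mk x ⁻¹' Y) ⊆ Prod.mk x ⁻¹' W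

variable {Y Y' W W' : Set (X × S)}

theorem IsFiberwiseInner.subset (h : IsFiberwiseInner Y W) : Y ⊆ W :=
  fun p hp => h p.1 (subset_closure (show p.2 ∈ Prod.mk p.1 ⁻¹' Y from hp))

theorem IsFiberwiseInner.mono (h : IsFiberwiseInner Y W) (hY : Y' ⊆ Y) (hW : W ⊆ W') :
    IsFiberwiseInner Y' W' :=
  fun x => (closure_mono (Set.preimage_mono hY)).trans ((h x).trans (Set.preimage_mono hW))

theorem IsFiberwiseInner.inter (h : IsFiberwiseInner Y W) (h' : IsFiberwiseInner Y W') :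
    IsFiberwiseInner Y (W ∩ W') :=
  fun x => Set.subset_inter (h x) (h' x)

theorem isFiberwiseInner_biUnion {ι : Type*} {t : Set ι} (ht : t.Finite) {Z : ι → Set (X × S)}
    (h : ∀ i ∈ t, IsFiberwiseInner (Z i) W) : IsFiberwiseInner (⋃ i ∈ t, Z i) W := by
  intro x
  simp only [Set.preimage_iUnion, ht.closure_biUnion]
  exact Set.iUnion₂_subset fun i hi => h i hi x

theorem isFiberwiseInner_prod {U : Set X} {V : Set S} (h : U ×ˢ closure V ⊆ W) :
    IsFiberwiseInner (U ×ˢ V) W := by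
  intro x s hs
  by_cases hx : x ∈ U
  · rw [Set.mk_preimage_prod_right hx] at hs
    exact h ⟨hx, hs⟩
  · simp [Set.mk_preimage_prod_right_eq_empty hx] at hs

end FiberwiseInner

section Restriction

variable {C : Type w} [Preorder C] {A : Type v} [Ring A]

/-- The restriction map `Γ(b; G) → Γ(a; G)` of a presheaf of modules on a preorder. -/
def res (G : Cᵒᵖ ⥤ ModuleCat.{w} A) {a b : C} (h : a ≤ b) :
    G.obj (op b) →ₗ[A] G.obj (op a) :=
  (G.map (homOfLE h).op).hom

theorem res_res (G : Cᵒᵖ ⥤ ModuleCat.{w} A) {a b c : C} (h : a ≤ b) (h' : b ≤ c)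
    (x : G.obj (op c)) : res G h (res G h' x) = res G (h.trans h') x :=
  congr($(G.map_comp (homOfLE h').op (homOfLE h).op).hom x).symm

variable {J : GrothendieckTopology C} {G : Cᵒᵖ ⥤ ModuleCat.{w} A} {W : C} {R : Sieve W}

theorem isSheaf_forget (hG : Presheaf.IsSheaf J G) :
    Presieve.IsSheaf J (G ⋙ forget (ModuleCat.{w} A)) :=
  (isSheaf_iff_isSheaf_of_type _ _).1
    ((Presheaf.isSheaf_iff_isSheaf_forget J G (forget (ModuleCat.{w} A))).1 hG)

theorem eq_of_res_eq (hG : Presheaf.IsSheaf J G) (hR : R ∈ J W) {x y : G.obj (op W)}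
    (h : ∀ (Z : C) (hZ : Z ≤ W), R.arrows (homOfLE hZ) → res G hZ x = res G hZ y) : x = y :=
  (isSheaf_forget hG R hR).isSeparatedFor.ext (t₁ := x) (t₂ := y) fun Z f hf =>
    h Z (leOfHom f) hf

theorem exists_res_eq (hG : Presheaf.IsSheaf J G) (hR : R ∈ J W)
    (x : ∀ (Z : C) (hZ : Z ≤ W), R.arrows (homOfLE hZ) → G.obj (op Z))
    (hx : ∀ (T Z Z' : C) (hT : T ≤ Z) (hT' : T ≤ Z') (hZ : Z ≤ W) (hZ' : Z' ≤ W)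
      (hR : R.arrows (homOfLE hZ)) (hR' : R.arrows (homOfLE hZ')),
      res G hT (x Z hZ hR) = res G hT' (x Z' hZ' hR')) :
    ∃ y : G.obj (op W), ∀ (Z : C) (hZ : Z ≤ W) (hR : R.arrows (homOfLE hZ)),
      res G hZ y = x Z hZ hR := by
  obtain ⟨y, hy, -⟩ := isSheaf_forget hG R hR (fun Z f hf => x Z (leOfHom f) hf)
    fun Z Z' T g g' f f' hf hf' _ => hx T Z Z' (leOfHom g) (leOfHom g') _ _ hf hf'
  exact ⟨y, fun Z hZ hR => hy (homOfLE hZ) hR⟩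

theorem ofObjects_eq_ofArrows {ι : Type*} {Z : ι → C} (hZ : ∀ i, Z i ≤ W) :
    Sieve.ofObjects Z W = Sieve.ofArrows Z fun i => homOfLE (hZ i) := by
  refine le_antisymm ?_ (Sieve.ofArrows_le_ofObjects _ _)
  rintro T f ⟨i, ⟨g⟩⟩
  exact (Sieve.mem_ofArrows_iff _ _ _).2 ⟨i, g, Subsingleton.elim _ _⟩

end Restriction

section LimitIso

variable {C : Type w} [Preorder C] {A : Type v} [Ring A] {J : GrothendieckTopology C}
  {G : Cᵒᵖ ⥤ ModuleCat.{w} A} {W : C} {ι : Type*} {Z : ι → C}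

theorem eq_of_forall_res_eq (hG : Presheaf.IsSheaf J G) (hZ : ∀ i, Z i ≤ W)
    (hcov : Sieve.ofObjects Z W ∈ J W) {x y : G.obj (op W)}
    (h : ∀ i, res G (hZ i) x = res G (hZ i) y) : x = y := by
  refine eq_of_res_eq hG hcov fun T hT => ?_
  rintro ⟨i, ⟨g⟩⟩
  rw [← res_res G (leOfHom g) (hZ i), h, res_res]

theorem exists_limit_π_eq {I : Type*} [Category* I] {K : I ⥤ ModuleCat.{w} A} [HasLimit K]
    [PreservesLimit K (forget (ModuleCat.{w} A))] (x : ∀ i, K.obj i)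
    (hx : ∀ {i j : I} (f : i ⟶ j), (K.map f).hom (x i) = x j) :
    ∃ y : (limit K : ModuleCat.{w} A), ∀ i, (limit.π K i).hom y = x i := by
  let t := isLimitOfPreserves (forget (ModuleCat.{w} A)) (limit.isLimit K)
  exact ⟨(Types.isLimitEquivSections t).symm ⟨x, hx⟩,
    fun i => Types.isLimitEquivSections_symm_apply t ⟨x, hx⟩ i⟩

theorem exists_limit_iso [Preorder ι] {K : ιᵒᵖ ⥤ ModuleCat.{w} A} [HasLimit K]
    [PreservesLimit K (forget (ModuleCat.{w} A))] (hG : Presheaf.IsSheaf J G)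
    (hZ : ∀ i, Z i ≤ W) (hcov : Sieve.ofObjects Z W ∈ J W)
    (φ : ∀ i, K.obj (op i) ⟶ G.obj (op (Z i)))
    (hφ : ∀ (x : (limit K : ModuleCat.{w} A)) (i j : ι) (T : C) (hi : T ≤ Z i) (hj : T ≤ Z j),
      res G hi ((φ i).hom ((limit.π K (op i)).hom x)) =
        res G hj ((φ j).hom ((limit.π K (op j)).hom x)))
    (hinj : ∀ x : (limit K : ModuleCat.{w} A), (∀ i, (φ i).hom ((limit.π K (op i)).hom x) = 0) →
      ∀ i, (limit.π K (op i)).hom x = 0)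
    (hsurj : ∀ α : G.obj (op W), ∃ x : ∀ i, K.obj (op i),
      (∀ i j (h : i ≤ j), (K.map (homOfLE h).op).hom (x j) = x i) ∧
        ∀ i, (φ i).hom (x i) = res G (hZ i) α) :
    ∃ e : limit K ≅ G.obj (op W),
      ∀ i, e.hom ≫ G.map (homOfLE (hZ i)).op = limit.π K (op i) ≫ φ i := by
  obtain ⟨e, he, -⟩ := hG.existsUnique_amalgamation_ofArrows (fun i => homOfLE (hZ i))
    (ofObjects_eq_ofArrows hZ ▸ hcov) (fun i => limit.π K (op i) ≫ φ i)
    fun T i j a b _ => ModuleCat.hom_ext (LinearMap.ext fun x => hφ x i j T (leOfHom a) (leOfHom b))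
  have he' : ∀ i x, res G (hZ i) (e.hom x) = (φ i).hom ((limit.π K (op i)).hom x) :=
    fun i x => congr($(he i).hom x)
  have hbij : Function.Bijective e.hom := by
    refine ⟨(injective_iff_map_eq_zero e.hom).2 fun x hx => Concrete.limit_ext K x 0 fun i =>
      (hinj x (fun i => ?_) i.unop).trans (map_zero (limit.π K i).hom).symm, fun α => ?_⟩
    · rw [← he', hx, map_zero]
    · obtain ⟨x, hx, hxα⟩ := hsurj α
      obtain ⟨y, hy⟩ := exists_limit_π_eq (fun i => x i.unop) fun f => hx _ _ (leOfHom f.unop)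
      refine ⟨y, eq_of_forall_res_eq hG hZ hcov fun i => ?_⟩
      rw [he', hy, hxα]
  exact ⟨(LinearEquiv.ofBijective e.hom hbij).toModuleIso, he⟩

end LimitIso

section Sites

variable {n d : ℕ} {X : Type u} {S : Type v} [TopologicalSpace X] [TopologicalSpace S]
  [ChartedSpace (EuclideanSpace ℝ (Fin n)) X] [ChartedSpace (EuclideanSpace ℝ (Fin d)) S]

theorem IsRelSubanalytic.inf [T2Space X] [IsManifold (𝓡 n) ω X] {W W' : Opens (X × S)}
    (h : IsRelSubanalytic X S n W) (h' : IsRelSubanalytic X S n W') :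
    IsRelSubanalytic X S n (W ⊓ W') := by
  obtain ⟨𝒬, hf, hQ, rfl⟩ := h
  obtain ⟨𝒬', hf', hQ', rfl⟩ := h'
  refine ⟨(fun p : Opens (X × S) × Opens (X × S) => p.1 ⊓ p.2) '' (𝒬 ×ˢ 𝒬'),
    (hf.prod hf').image _, ?_, by rw [sSup_inf_sSup, sSup_image]⟩
  rintro _ ⟨⟨Q, Q'⟩, ⟨hQ𝒬, hQ𝒬'⟩, rfl⟩
  obtain ⟨U, V, hU, rfl⟩ := hQ Q hQ𝒬
  obtain ⟨U', V', hU', rfl⟩ := hQ' Q' hQ𝒬'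
  exact ⟨U ⊓ U', V ⊓ V', hU.inter hU', rect_inf _ _ _ _⟩

theorem exists_finite_rect_le {t : Set (SaTop X S n)} (ht : t.Finite) (s : S) :
    ∃ (N : Opens S) (𝒰 : Set (Opens X)), s ∈ N ∧ 𝒰.Finite ∧
      (∀ U ∈ 𝒰, IsSubanalytic n (U : Set X) ∧ ∃ Z ∈ t, rect U N ≤ Z.1) ∧
      ∀ x, ∀ Z ∈ t, (x, s) ∈ Z.1 → ∃ U ∈ 𝒰, x ∈ U := by
  choose 𝒬 hf hQ hZ using fun Z : SaTop X S n => Z.2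
  choose! A B hA hAB using hQ
  let T : Set (SaTop X S n × Opens (X × S)) := {p | p.1 ∈ t ∧ p.2 ∈ 𝒬 p.1 ∧ s ∈ B p.1 p.2}
  have hT : T.Finite := by
    refine (ht.biUnion fun Z _ => (hf Z).image (Prod.mk Z)).subset ?_
    rintro ⟨Z, Q⟩ ⟨hZt, hQ, -⟩
    exact Set.mem_iUnion₂.2 ⟨Z, hZt, Q, hQ, rfl⟩
  refine ⟨⟨⋂ p ∈ T, (B p.1 p.2 : Set S), hT.isOpen_biInter fun p _ => (B p.1 p.2).isOpen⟩,
    (fun p => A p.1 p.2) '' T, Set.mem_iInter₂.2 fun p hp => hp.2.2, hT.image _, ?_, ?_⟩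
  · rintro _ ⟨⟨Z, Q⟩, hp, rfl⟩
    refine ⟨hA Z Q hp.2.1, Z, hp.1, ?_⟩
    rw [hZ Z]
    exact (Set.prod_mono_right (Set.biInter_subset_of_mem hp)).trans
      ((hAB Z Q hp.2.1).ge.trans (le_sSup hp.2.1))
  · intro x Z hZt hx
    rw [hZ Z] at hx
    obtain ⟨Q, hQ, hxQ⟩ := Opens.mem_sSup.1 hx
    rw [hAB Z Q hQ] at hxQ
    exact ⟨_, ⟨(Z, Q), ⟨hZt, hQ, hxQ.2⟩, rfl⟩, hxQ.1⟩

theorem exists_rect_le {W : SaTop X S n} {U : Opens X} {s : S}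
    (h : (U : Set X) ×ˢ {s} ⊆ (W.1 : Set (X × S))) : ∃ N : Opens S, s ∈ N ∧ rect U N ≤ W.1 := by
  obtain ⟨N, 𝒰, hsN, -, h𝒰, hcov⟩ := exists_finite_rect_le (Set.finite_singleton W) s
  refine ⟨N, hsN, fun p hp => ?_⟩
  obtain ⟨U', hU', hpU'⟩ := hcov p.1 W rfl (h ⟨hp.1, rfl⟩)
  obtain ⟨-, _, rfl, hle⟩ := h𝒰 U' hU'
  exact hle ⟨hpU', hp.2⟩

theorem exists_subanalytic_closure_subset [T2Space S] [IsManifold (𝓡 d) ω S] {N : Opens S} {s : S}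
    (hs : s ∈ N) : ∃ M : Opens S, s ∈ M ∧ (IsSubanalytic d (M : Set S) ∧
      IsCompact (closure (M : Set S))) ∧ closure (M : Set S) ⊆ N := by
  have : LocallyCompactSpace S := ChartedSpace.locallyCompactSpace (EuclideanSpace ℝ (Fin d)) S
  obtain ⟨K, hK, hKc, hKN⟩ := exists_mem_nhds_isClosed_subset (N.isOpen.mem_nhds hs)
  obtain ⟨M, ⟨hMo, hsM, hM, hMc⟩, hMK⟩ := (hasBasis_subanalytic (n := d) s).mem_iff.1 hK
  exact ⟨⟨M, hMo⟩, hsM, ⟨hM, hMc⟩, (closure_minimal hMK hKc).trans hKN⟩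

variable (d) in
theorem exists_basicRect_isFiberwiseInner [T2Space S] [IsManifold (𝓡 d) ω S] {W : SaTop X S n}
    {U : Opens X} (hU : IsSubanalytic n (U : Set X)) (hUc : IsCompact (closure (U : Set X)))
    {s : S} (h : (U : Set X) ×ˢ {s} ⊆ (W.1 : Set (X × S))) :
    ∃ Q ∈ basicRects X S n d, (U : Set X) ×ˢ {s} ⊆ (Q : Set (X × S)) ∧
      IsFiberwiseInner (Q : Set (X × S)) W.1 := by
  obtain ⟨N, hsN, hN⟩ := exists_rect_le h
  obtain ⟨M, hsM, hM, hMN⟩ := exists_subanalytic_closure_subset (d := d) hsN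
  exact ⟨rect U M, ⟨U, M, ⟨hU, hUc⟩, hM, rfl⟩, Set.prod_mono_right (by simpa using hsM),
    isFiberwiseInner_prod ((Set.prod_mono_right hMN).trans hN)⟩

theorem isRelSubanalytic_of_mem_basicRects {Q : Opens (X × S)} (hQ : Q ∈ basicRects X S n d) :
    IsRelSubanalytic X S n Q := by
  obtain ⟨U, V, hU, -, rfl⟩ := hQ
  exact (SaTop.rect U hU.1 V).2

theorem isCompact_closure_of_mem_basicRects {Q : Opens (X × S)} (hQ : Q ∈ basicRects X S n d) :
    IsCompact (closure (Q : Set (X × S))) := by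
  obtain ⟨U, V, hU, hV, rfl⟩ := hQ
  exact (closure_prod_eq (s := (U : Set X)) (t := (V : Set S))).symm ▸ hU.2.prod hV.2

theorem IsBisubanalytic.isRelSubanalytic_inf [T2Space X] [IsManifold (𝓡 n) ω X] [T2Space S]
    [IsManifold (𝓡 d) ω S] {W Q : Opens (X × S)} (hW : IsBisubanalytic X S n d W)
    (hQ : Q ∈ basicRects X S n d) : IsRelSubanalytic X S n (W ⊓ Q) := by
  obtain ⟨𝒬, h𝒬, hl, rfl⟩ := hW
  have hfin := hl.finite_nonempty_inter_compact (isCompact_closure_of_mem_basicRects hQ)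
  refine ⟨(fun P : 𝒬 => P.1 ⊓ Q) '' _, hfin.image _, ?_, ?_⟩
  · rintro _ ⟨P, -, rfl⟩
    obtain ⟨U, V, hU, -, hUV⟩ := basicRects_inf (h𝒬 P.2) hQ
    exact ⟨U, V, hU.1, hUV⟩
  · rw [sSup_inf_eq]
    refine le_antisymm (iSup₂_le fun P hP p hp => ?_) (sSup_le ?_)
    · exact Opens.mem_sSup.2 ⟨_, ⟨⟨P, hP⟩, ⟨p, hp.1, subset_closure hp.2⟩, rfl⟩, hp⟩
    · rintro _ ⟨P, -, rfl⟩
      exact le_iSup₂_of_le P.1 P.2 le_rfl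

variable [T2Space X] [IsManifold (𝓡 n) ω X]

theorem mem_saTopTopology_iff {W : SaTop X S n} {R : Sieve W} :
    R ∈ saTopTopology n X S W ↔ ∀ U : Opens X, IsSubanalytic n (U : Set X) →
      IsCompact (closure (U : Set X)) → ∀ s : S, (U : Set X) ×ˢ {s} ⊆ (W.1 : Set (X × S)) →
      ∃ t : Set (SaTop X S n), t.Finite ∧ (∀ Z ∈ t, ∃ h : Z ≤ W, R.arrows (homOfLE h)) ∧
        (U : Set X) ×ˢ {s} ⊆ ⋃ Z ∈ t, (Z.1 : Set (X × S)) := by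
  rw [saTopTopology_eq]
  constructor
  · intro hR U hU hUc s hUs
    obtain ⟨V, hsV, hV⟩ := exists_rect_le hUs
    obtain ⟨N, hsN, -, 𝒰, hfin, hsup, h𝒰⟩ := hR U hU hUc V hV s hsV
    choose hsub hle hR𝒰 using h𝒰
    have := hfin.to_subtype
    refine ⟨Set.range fun U' : 𝒰 => SaTop.rect U'.1 (hsub U' U'.2) N, Set.finite_range _, ?_, ?_⟩
    · rintro _ ⟨U', rfl⟩
      exact ⟨hle U' U'.2, hR𝒰 U' U'.2⟩
    · rintro ⟨x, _⟩ ⟨hx, rfl⟩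
      obtain ⟨U', hU', hxU'⟩ := Opens.mem_sSup.1 (hsup ▸ hx : x ∈ sSup 𝒰)
      exact Set.mem_iUnion₂.2 ⟨_, ⟨⟨U', hU'⟩, rfl⟩, hxU', hsN⟩
  · intro hR U hU hUc V hUV s hs
    obtain ⟨t, ht, htR, htc⟩ := hR U hU hUc s ((Set.prod_mono_right (by simpa using hs)).trans hUV)
    obtain ⟨N, 𝒰, hsN, hfin, h𝒰, hcov⟩ := exists_finite_rect_le ht s
    refine ⟨V ⊓ N, ⟨hs, hsN⟩, inf_le_left, (U ⊓ ·) '' 𝒰, hfin.image _, ?_, ?_⟩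
    · refine le_antisymm (fun x hx => ?_) (sSup_le ?_)
      · obtain ⟨Z, hZ, hxZ⟩ := Set.mem_iUnion₂.1 (htc (show (x, s) ∈ _ from ⟨hx, rfl⟩))
        obtain ⟨U', hU', hxU'⟩ := hcov x Z hZ hxZ
        exact Opens.mem_sSup.2 ⟨_, ⟨U', hU', rfl⟩, hx, hxU'⟩
      · rintro _ ⟨U', -, rfl⟩
        exact inf_le_left
    · rintro _ ⟨U', hU', rfl⟩
      obtain ⟨hsub, Z, hZ, hle⟩ := h𝒰 U' hU'
      obtain ⟨hZW, hRZ⟩ := htR Z hZ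
      have hUZ : SaTop.rect (U ⊓ U') (hU.inter hsub) (V ⊓ N) ≤ Z :=
        (Set.prod_mono Set.inter_subset_right Set.inter_subset_right).trans hle
      exact ⟨hU.inter hsub, hUZ.trans hZW, R.downward_closed hRZ (homOfLE hUZ)⟩

theorem ofObjects_mem_saTopTopology {W : SaTop X S n} {ι : Type*} {Z : ι → SaTop X S n}
    (hZ : ∀ i, Z i ≤ W)
    (h : ∀ U : Opens X, IsSubanalytic n (U : Set X) → IsCompact (closure (U : Set X)) → ∀ s : S,
      (U : Set X) ×ˢ {s} ⊆ (W.1 : Set (X × S)) →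
      ∃ t : Set ι, t.Finite ∧ (U : Set X) ×ˢ {s} ⊆ ⋃ i ∈ t, ((Z i).1 : Set (X × S))) :
    Sieve.ofObjects Z W ∈ saTopTopology n X S W := by
  refine mem_saTopTopology_iff.2 fun U hU hUc s hUs => ?_
  obtain ⟨t, ht, hcov⟩ := h U hU hUc s hUs
  refine ⟨Z '' t, ht.image Z, ?_, by rwa [Set.biUnion_image]⟩
  rintro _ ⟨i, -, rfl⟩
  exact ⟨hZ i, i, ⟨𝟙 _⟩⟩

theorem exists_mem_of_mem_saTopTopology {W : SaTop X S n} {R : Sieve W}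
    (hR : R ∈ saTopTopology n X S W) {p : X × S} (hp : p ∈ W.1) :
    ∃ (Z : SaTop X S n) (h : Z ≤ W), R.arrows (homOfLE h) ∧ p ∈ Z.1 := by
  have hWp : (Prod.mk · p.2) ⁻¹' (W.1 : Set (X × S)) ∈ 𝓝 p.1 :=
    (W.1.isOpen.preimage (by fun_prop)).mem_nhds hp
  obtain ⟨U, ⟨hUo, hpU, hU, hUc⟩, hUW⟩ := (hasBasis_subanalytic (n := n) p.1).mem_iff.1 hWp
  obtain ⟨t, -, htR, hcov⟩ := mem_saTopTopology_iff.1 hR ⟨U, hUo⟩ hU hUc p.2 (by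
    rintro ⟨x, _⟩ ⟨hx, rfl⟩
    exact hUW hx)
  obtain ⟨Z, hZ, hpZ⟩ := Set.mem_iUnion₂.1 (hcov (show p ∈ _ from ⟨hpU, rfl⟩))
  obtain ⟨hZW, hRZ⟩ := htR Z hZ
  exact ⟨Z, hZW, hRZ, hpZ⟩

theorem IsWeaklyQuasiCompact.of_le {W' W W'' : SaTop X S n} {h : W' ≤ W}
    (hW' : IsWeaklyQuasiCompact (saTopTopology n X S) h) (h' : W'' ≤ W') :
    IsWeaklyQuasiCompact (saTopTopology n X S) (h'.trans h) := by
  intro R hR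
  obtain ⟨t, ht, htR, htc⟩ := hW' R hR
  let f : SaTop X S n → SaTop X S n := fun Z => ⟨Z.1 ⊓ W''.1, Z.2.inf W''.2⟩
  refine ⟨f '' t, ht.image f, ?_, (saTopTopology n X S).superset_covering ?_
    ((saTopTopology n X S).pullback_stable (homOfLE h') htc)⟩
  · rintro _ ⟨Z, hZ, rfl⟩
    obtain ⟨hZ', hRZ⟩ := htR Z hZ
    exact ⟨inf_le_right (a := Z.1), R.downward_closed hRZ (homOfLE (inf_le_left (a := Z.1)))⟩
  · rintro T g ⟨Z, ⟨k⟩⟩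
    exact ⟨⟨f Z.1, Z.1, Z.2, rfl⟩,
      ⟨homOfLE (Set.subset_inter (leOfHom k) (leOfHom g) : T ≤ f Z.1)⟩⟩

theorem IsWeaklyQuasiCompact.isFiberwiseInner [RegularSpace S] {W' W : SaTop X S n} {h : W' ≤ W}
    (hW' : IsWeaklyQuasiCompact (saTopTopology n X S) h) :
    IsFiberwiseInner (W'.1 : Set (X × S)) W.1 := by
  let ι := {Q : SaTop X S n // IsFiberwiseInner (Q.1 : Set (X × S)) W.1}
  have hcov : Sieve.ofObjects (fun Q : ι => Q.1) W ∈ saTopTopology n X S W :=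
    ofObjects_mem_saTopTopology (fun Q => Q.2.subset) fun U hU _ s hUs => by
      obtain ⟨N, hsN, hN⟩ := exists_rect_le hUs
      obtain ⟨M, ⟨hsM, hM⟩, hMN⟩ :=
        (hasBasis_opens_closure s).mem_iff.1 (N.isOpen.mem_nhds hsN)
      exact ⟨{⟨SaTop.rect U hU ⟨M, hM⟩,
          isFiberwiseInner_prod ((Set.prod_mono_right hMN).trans hN)⟩}, Set.finite_singleton _,
        fun p hp => Set.mem_iUnion₂.2
          ⟨_, rfl, (show p ∈ (U : Set X) ×ˢ M from ⟨hp.1, (show p.2 = s from hp.2) ▸ hsM⟩)⟩⟩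
  obtain ⟨t, ht, htcov, htW'⟩ := hW' _ hcov
  refine (isFiberwiseInner_biUnion (Z := fun Z : SaTop X S n => (Z.1 : Set (X × S))) ht
    fun Z hZ => ?_).mono (fun p hp => ?_) subset_rfl
  · obtain ⟨-, Q, ⟨g⟩⟩ := htcov Z hZ
    exact Q.2.mono (leOfHom g) subset_rfl
  · obtain ⟨T, -, ⟨Z, ⟨g⟩⟩, hpT⟩ := exists_mem_of_mem_saTopTopology htW' hp
    exact Set.mem_iUnion₂.2 ⟨Z, Z.2, leOfHom g hpT⟩

variable [T2Space S] [IsManifold (𝓡 d) ω S]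

theorem exists_finite_basicRects_nhds {W : SaTop X S n} {R : Sieve W}
    (hR : R ∈ saTopTopology n X S W) {U : Opens X} (hU : IsSubanalytic n (U : Set X))
    (hUc : IsCompact (closure (U : Set X))) {s : S}
    (hUs : (U : Set X) ×ˢ {s} ⊆ (W.1 : Set (X × S))) :
    ∃ M : Opens S, s ∈ M ∧ ∃ t ⊆ basicRects X S n d, t.Finite ∧
      (∀ T ∈ t, ∃ (Z : SaTop X S n) (h : Z ≤ W), R.arrows (homOfLE h) ∧
        IsFiberwiseInner (T : Set (X × S)) Z.1) ∧ rect U M ≤ sSup t := by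
  obtain ⟨t, ht, htR, hcov⟩ := mem_saTopTopology_iff.1 hR U hU hUc s hUs
  obtain ⟨N, 𝒰, hsN, h𝒰fin, h𝒰, h𝒰cov⟩ := exists_finite_rect_le ht s
  obtain ⟨M, hsM, hM, hMN⟩ := exists_subanalytic_closure_subset (d := d) hsN
  refine ⟨M, hsM, (fun U' => rect (U ⊓ U') M) '' 𝒰, ?_, h𝒰fin.image _, ?_, ?_⟩
  · rintro _ ⟨U', hU', rfl⟩
    exact ⟨_, _, ⟨hU.inter (h𝒰 U' hU').1, hUc.closure_of_subset
      (Set.inter_subset_left.trans subset_closure)⟩, hM, rfl⟩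
  · rintro _ ⟨U', hU', rfl⟩
    obtain ⟨Z, hZ, hle⟩ := (h𝒰 U' hU').2
    obtain ⟨hZW, hRZ⟩ := htR Z hZ
    exact ⟨Z, hZW, hRZ, isFiberwiseInner_prod
      ((Set.prod_mono Set.inter_subset_right hMN).trans hle)⟩
  · rintro ⟨x, s'⟩ ⟨hx, hs'⟩
    obtain ⟨Z, hZ, hxZ⟩ := Set.mem_iUnion₂.1 (hcov (show (x, s) ∈ _ from ⟨hx, rfl⟩))
    obtain ⟨U', hU', hxU'⟩ := h𝒰cov x Z hZ hxZ
    exact Opens.mem_sSup.2 ⟨_, ⟨U', hU', rfl⟩, ⟨hx, hxU'⟩, hs'⟩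

theorem exists_finite_basicRects {W : SaTop X S n} {R : Sieve W}
    (hR : R ∈ saTopTopology n X S W) {Q : Opens (X × S)} (hQ : Q ∈ basicRects X S n d)
    (hQW : IsFiberwiseInner (Q : Set (X × S)) W.1) :
    ∃ t ⊆ basicRects X S n d, t.Finite ∧ (∀ T ∈ t, T ≤ Q ∧
      ∃ (Z : SaTop X S n) (h : Z ≤ W), R.arrows (homOfLE h) ∧
        IsFiberwiseInner (T : Set (X × S)) Z.1) ∧ Q = sSup t := by
  obtain ⟨U, V, ⟨hU, hUc⟩, hV, rfl⟩ := id hQ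
  have hUs : ∀ s ∈ closure (V : Set S), (U : Set X) ×ˢ {s} ⊆ (W.1 : Set (X × S)) := by
    rintro s hs ⟨x, _⟩ ⟨hx, rfl⟩
    exact hQW x (by rwa [rect, Opens.coe_mk, Set.mk_preimage_prod_right hx])
  choose! M hsM t htb htf htR htc using fun s hs =>
    exists_finite_basicRects_nhds (d := d) hR hU hUc (hUs s hs)
  obtain ⟨b, hb, hbV⟩ := hV.2.elim_nhds_subcover (fun s => (M s : Set S))
    fun s hs => (M s).isOpen.mem_nhds (hsM s hs)
  refine ⟨(· ⊓ rect U V) '' ⋃ s ∈ b, t s, ?_, (b.finite_toSet.biUnion fun s hs =>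
    htf s (hb s hs)).image _, ?_, le_antisymm ?_ (sSup_le ?_)⟩
  · rintro _ ⟨T, hT, rfl⟩
    obtain ⟨s, hs, hT⟩ := Set.mem_iUnion₂.1 hT
    exact basicRects_inf (htb s (hb s hs) hT) hQ
  · rintro _ ⟨T, hT, rfl⟩
    obtain ⟨s, hs, hT⟩ := Set.mem_iUnion₂.1 hT
    obtain ⟨Z, hZ, hRZ, hTZ⟩ := htR s (hb s hs) T hT
    exact ⟨inf_le_right, Z, hZ, hRZ, hTZ.mono Set.inter_subset_left subset_rfl⟩
  · rintro ⟨x, s'⟩ hp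
    obtain ⟨s, hs, hs'⟩ := Set.mem_iUnion₂.1 (hbV (subset_closure hp.2))
    obtain ⟨T, hT, hpT⟩ := Opens.mem_sSup.1 (htc s (hb s hs) (show (x, s') ∈ _ from ⟨hp.1, hs'⟩))
    exact Opens.mem_sSup.2 ⟨_, ⟨T, Set.mem_iUnion₂.2 ⟨s, hs, hT⟩, rfl⟩, hpT, hp⟩
  · rintro _ ⟨T, -, rfl⟩
    exact inf_le_right

theorem exists_saSaTopology_isFiberwiseInner {W : SaTop X S n} {R : Sieve W}
    (hR : R ∈ saTopTopology n X S W) {Y : SaSa X S n d}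
    (hY : IsFiberwiseInner (Y.1 : Set (X × S)) W.1) :
    ∃ R' ∈ saSaTopology n d X S Y, ∀ (T : SaSa X S n d) (hT : T ≤ Y), R'.arrows (homOfLE hT) →
      ∃ (Z : SaTop X S n) (h : Z ≤ W), R.arrows (homOfLE h) ∧
        IsFiberwiseInner (T.1 : Set (X × S)) Z.1 := by
  let R' : Sieve Y :=
    { arrows := fun T _ => ∃ (Z : SaTop X S n) (h : Z ≤ W), R.arrows (homOfLE h) ∧
        IsFiberwiseInner (T.1 : Set (X × S)) Z.1
      downward_closed := by
        rintro T T' _ ⟨Z, hZ, hRZ, hTZ⟩ g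
        exact ⟨Z, hZ, hRZ, hTZ.mono (leOfHom g) subset_rfl⟩ }
  refine ⟨R', fun Q hQ hQY => ?_, fun T hT h => h⟩
  obtain ⟨t, htb, htf, htR, htc⟩ := exists_finite_basicRects hR hQ (hY.mono hQY subset_rfl)
  refine ⟨Subtype.val ⁻¹' t, htf.preimage Subtype.val_injective.injOn, fun T hT =>
    ⟨(htR T.1 hT).1.trans hQY, (htR T.1 hT).2⟩, fun p hp => ?_⟩
  obtain ⟨T, hT, hpT⟩ := Opens.mem_sSup.1 (htc ▸ hp : p ∈ sSup t)
  exact Set.mem_iUnion₂.2 ⟨⟨T, isBisubanalytic_of_mem (htb hT)⟩, hT, hpT⟩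

theorem exists_saTopTopology_of_saSaTopology {Y : SaSa X S n d} {R : Sieve Y}
    (hR : R ∈ saSaTopology n d X S Y) {Z : SaTop X S n} (hZY : Z.1 ≤ Y.1) :
    ∃ R' ∈ saTopTopology n X S Z, ∀ (T : SaTop X S n) (hT : T ≤ Z), R'.arrows (homOfLE hT) →
      ∃ (T' : SaSa X S n d) (h : T' ≤ Y), R.arrows (homOfLE h) ∧ T.1 ≤ T'.1 := by
  let R' : Sieve Z :=
    { arrows := fun T _ => ∃ (T' : SaSa X S n d) (h : T' ≤ Y), R.arrows (homOfLE h) ∧ T.1 ≤ T'.1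
      downward_closed := by
        rintro T T' _ ⟨M, hM, hRM, hTM⟩ g
        exact ⟨M, hM, hRM, Set.Subset.trans (leOfHom g) hTM⟩ }
  refine ⟨R', mem_saTopTopology_iff.2 fun U hU hUc s hUs => ?_, fun T hT h => h⟩
  obtain ⟨Q, hQ, hUQ, hQZ⟩ := exists_basicRect_isFiberwiseInner d hU hUc hUs
  obtain ⟨t, ht, htR, htc⟩ := hR Q hQ (hQZ.subset.trans hZY)
  refine ⟨(fun T' => ⟨T'.1 ⊓ Q, T'.2.isRelSubanalytic_inf hQ⟩) '' t, ht.image _, ?_, ?_⟩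
  · rintro _ ⟨T', hT', rfl⟩
    obtain ⟨h, hRT'⟩ := htR T' hT'
    exact ⟨Set.inter_subset_right.trans hQZ.subset, T', h, hRT', inf_le_left⟩
  · intro p hp
    obtain ⟨T', hT', hpT'⟩ := Set.mem_iUnion₂.1 (htc (hUQ hp))
    exact Set.mem_iUnion₂.2 ⟨_, ⟨T', hT', rfl⟩, hpT', hUQ hp⟩

theorem isWeaklyQuasiCompact_of_mem_basicRects {W Q : SaTop X S n}
    (hQ : Q.1 ∈ basicRects X S n d) (h : IsFiberwiseInner (Q.1 : Set (X × S)) W.1)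
    (hQW : Q ≤ W) : IsWeaklyQuasiCompact (saTopTopology n X S) hQW := by
  intro R hR
  obtain ⟨t, htb, htf, htR, htc⟩ := exists_finite_basicRects hR hQ h
  have hfin : (Subtype.val ⁻¹' t : Set (SaTop X S n)).Finite :=
    htf.preimage Subtype.val_injective.injOn
  have := hfin.to_subtype
  refine ⟨Subtype.val ⁻¹' t, hfin, fun T hT => ?_, ofObjects_mem_saTopTopology
    (fun T => (htR T.1.1 T.2).1) fun U _ _ s hUs => ⟨Set.univ, Set.finite_univ, fun p hp => ?_⟩⟩
  · obtain ⟨hTQ, Z, hZ, hRZ, hTZ⟩ := htR T.1 hT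
    exact ⟨hTQ, R.downward_closed hRZ (homOfLE (show T ≤ Z from hTZ.subset))⟩
  · obtain ⟨T, hT, hpT⟩ := Opens.mem_sSup.1 (htc ▸ hUs hp : p ∈ sSup t)
    exact Set.mem_iUnion₂.2
      ⟨⟨⟨T, isRelSubanalytic_of_mem_basicRects (htb hT)⟩, hT⟩, trivial, hpT⟩

end Sites

noncomputable section PullbackSection

variable {n d : ℕ} {X : Type u} {S : Type v} [TopologicalSpace X] [TopologicalSpace S]
  [ChartedSpace (EuclideanSpace ℝ (Fin n)) X] [ChartedSpace (EuclideanSpace ℝ (Fin d)) S]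
  [T2Space X] [T2Space S] [IsManifold (𝓡 n) ω X] [IsManifold (𝓡 d) ω S]

section Maps

variable (F : SaSaSheaf n d X S) {Y Y' : SaSa X S n d} {Z Z' : SaTop X S n}

/-- The canonical map `Γ(Y; F) → colim Γ(Y'; F)`, where `Y'` runs over the objects of
`X_sa × S_sa` containing `Z`, for `Z ⊆ Y`. -/
def toPreInverseImage (h : Z.1 ≤ Y.1) : F.obj.obj (op Y) →ₗ[ℂ] (preInverseImage F).obj (op Z) :=
  res ((saSaInclusion n d X S).op.lan.obj F.obj) h ∘ₗ
    (((saSaInclusion n d X S).op.lanUnit.app F.obj).app (op Y)).hom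

/-- The canonical map `Γ(Y; F) → Γ(Z; a⁻¹F)`, for `Z ⊆ Y`. -/
def pullbackSection (h : Z.1 ≤ Y.1) : F.obj.obj (op Y) →ₗ[ℂ] (inverseImage F).obj.obj (op Z) :=
  ((toSheafify (saTopTopology n X S) (preInverseImage F)).app (op Z)).hom ∘ₗ toPreInverseImage F h

theorem res_toPreInverseImage (h : Z.1 ≤ Y.1) (h' : Z' ≤ Z) (y : F.obj.obj (op Y)) :
    res (preInverseImage F) h' (toPreInverseImage F h y) =
      toPreInverseImage F (Set.Subset.trans h' h) y :=
  res_res ((saSaInclusion n d X S).op.lan.obj F.obj) (show Z'.1 ≤ Z.1 from h') h _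

theorem toPreInverseImage_res (h : Z.1 ≤ Y'.1) (h' : Y' ≤ Y) (y : F.obj.obj (op Y)) :
    toPreInverseImage F h (res F.obj h' y) = toPreInverseImage F (Set.Subset.trans h h') y :=
  (congrArg (res _ h) congr($(((saSaInclusion n d X S).op.lanUnit.app F.obj).naturality
    (homOfLE h').op).hom y)).trans (res_res _ h (show Y'.1 ≤ Y.1 from h') _)

theorem res_pullbackSection (h : Z.1 ≤ Y.1) (h' : Z' ≤ Z) (y : F.obj.obj (op Y)) :
    res (inverseImage F).obj h' (pullbackSection F h y) =
      pullbackSection F (Set.Subset.trans h' h) y :=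
  congr($((toSheafify (saTopTopology n X S) (preInverseImage F)).naturality
    (homOfLE h').op).hom (toPreInverseImage F h y)).symm.trans
      (congrArg _ (res_toPreInverseImage F h h' y))

theorem pullbackSection_res (h : Z.1 ≤ Y'.1) (h' : Y' ≤ Y) (y : F.obj.obj (op Y)) :
    pullbackSection F h (res F.obj h' y) = pullbackSection F (Set.Subset.trans h h') y :=
  congrArg _ (toPreInverseImage_res F h h' y)

theorem toInverseImage_apply (W : Opens (X × S)) (h : IsBisubanalytic X S n d W)
    (h' : IsRelSubanalytic X S n W) (y : F.obj.obj (op ⟨W, h⟩)) :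
    (toInverseImage F W h h').hom y =
      pullbackSection F (Y := ⟨W, h⟩) (Z := ⟨W, h'⟩) le_rfl y :=
  congrArg _ congr($(((saSaInclusion n d X S).op.lan.obj F.obj).map_id (op W)).hom _).symm

end Maps

variable [SecondCountableTopology X] [SecondCountableTopology S]

theorem isBisubanalytic_top : IsBisubanalytic X S n d ⊤ := by
  obtain ⟨α, f, hf, hft, hfl⟩ := exists_locallyFinite_subanalytic (n := n) X
  obtain ⟨β, g, hg, hgt, hgl⟩ := exists_locallyFinite_subanalytic (n := d) S
  suffices h : (⊤ : Opens (X × S)) = ⨆ p : α × β, rect (f p.1) (g p.2) by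
    rw [h]
    refine isBisubanalytic_iSup _ (fun p => ⟨_, _, hf p.1, hg p.2, rfl⟩) fun x => ?_
    obtain ⟨t, ht, htf⟩ := hfl x.1
    obtain ⟨t', ht', htg⟩ := hgl x.2
    refine ⟨t ×ˢ t', prod_mem_nhds ht ht', (htf.prod htg).subset ?_⟩
    rintro p ⟨y, hy, hy'⟩
    exact ⟨⟨y.1, hy.1, hy'.1⟩, ⟨y.2, hy.2, hy'.2⟩⟩
  refine (top_le_iff.1 fun x _ => ?_).symm
  obtain ⟨a, ha⟩ := Opens.mem_iSup.1 (hft ▸ trivial : x.1 ∈ ⨆ a, f a)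
  obtain ⟨b, hb⟩ := Opens.mem_iSup.1 (hgt ▸ trivial : x.2 ∈ ⨆ b, g b)
  exact Opens.mem_iSup.2 ⟨(a, b), ha, hb⟩

theorem isFiltered_costructuredArrow (Z : Opens (X × S)) :
    IsFiltered (CostructuredArrow (saSaInclusion n d X S).op (op Z)) where
  nonempty := ⟨CostructuredArrow.mk (Y := op ⟨⊤, isBisubanalytic_top⟩) (homOfLE le_top).op⟩
  cocone_objs A B := by
    let M : SaSa X S n d := ⟨A.left.unop.1 ⊓ B.left.unop.1, A.left.unop.2.inf B.left.unop.2⟩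
    exact ⟨CostructuredArrow.mk (Y := op M)
        (homOfLE (le_inf (leOfHom A.hom.unop) (leOfHom B.hom.unop))).op,
      CostructuredArrow.homMk (homOfLE (inf_le_left : M.1 ≤ A.left.unop.1) : M ⟶ A.left.unop).op
        (Subsingleton.elim _ _),
      CostructuredArrow.homMk (homOfLE (inf_le_right : M.1 ≤ B.left.unop.1) : M ⟶ B.left.unop).op
        (Subsingleton.elim _ _), trivial⟩
  cocone_maps A B f g := ⟨B, 𝟙 _, by ext; exact Subsingleton.elim _ _⟩

variable (F : SaSaSheaf n d X S) {Z : SaTop X S n}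

theorem exists_toPreInverseImage_eq (p : (preInverseImage F).obj (op Z)) :
    ∃ (Y : SaSa X S n d) (h : Z.1 ≤ Y.1) (y : F.obj.obj (op Y)), toPreInverseImage F h y = p := by
  have hc := (saSaInclusion n d X S).op.isPointwiseLeftKanExtensionLeftKanExtensionUnit
    F.obj (op Z.1)
  have := isFiltered_costructuredArrow (n := n) (d := d) Z.1
  obtain ⟨j, y, hy⟩ := Concrete.isColimit_exists_rep _ hc p
  exact ⟨j.left.unop, leOfHom j.hom.unop, y, hy⟩

variable {F} in
theorem exists_res_eq_zero_of_toPreInverseImage_eq_zero {Y : SaSa X S n d} {h : Z.1 ≤ Y.1}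
    {y : F.obj.obj (op Y)} (hy : toPreInverseImage F h y = 0) :
    ∃ (Y' : SaSa X S n d) (_ : Z.1 ≤ Y'.1) (h' : Y' ≤ Y), res F.obj h' y = 0 := by
  have hc := (saSaInclusion n d X S).op.isPointwiseLeftKanExtensionLeftKanExtensionUnit
    F.obj (op Z.1)
  have := isFiltered_costructuredArrow (n := n) (d := d) Z.1
  let j : CostructuredArrow (saSaInclusion n d X S).op (op Z.1) :=
    CostructuredArrow.mk (Y := op Y) (homOfLE h).op
  obtain ⟨k, f, g, hk⟩ := Concrete.isColimit_exists_of_rep_eq _ hc (i := j) (j := j) y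
    (0 : F.obj.obj (op Y)) (hy.trans (map_zero (toPreInverseImage F h)).symm)
  exact ⟨k.left.unop, leOfHom k.hom.unop, leOfHom f.left.unop,
    hk.trans (map_zero (res F.obj (leOfHom g.left.unop)))⟩

theorem exists_sieve_pullbackSection_eq {W : SaTop X S n} (α : (inverseImage F).obj.obj (op W)) :
    ∃ R ∈ saTopTopology n X S W, ∀ (Z : SaTop X S n) (hZ : Z ≤ W), R.arrows (homOfLE hZ) →
      ∃ (Y : SaSa X S n d) (h : Z.1 ≤ Y.1) (y : F.obj.obj (op Y)),
        pullbackSection F h y = res (inverseImage F).obj hZ α := by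
  refine ⟨_, Presheaf.imageSieve_mem (saTopTopology n X S)
    (toSheafify (saTopTopology n X S) (preInverseImage F)) (U := op W) α, ?_⟩
  rintro Z hZ ⟨p, hp⟩
  obtain ⟨Y, h, y, rfl⟩ := exists_toPreInverseImage_eq F p
  exact ⟨Y, h, y, hp⟩

variable {F} in
theorem exists_sieve_res_eq_zero {Y : SaSa X S n d} {h : Z.1 ≤ Y.1} {y : F.obj.obj (op Y)}
    (hy : pullbackSection F h y = 0) :
    ∃ R ∈ saTopTopology n X S Z, ∀ (T : SaTop X S n) (hT : T ≤ Z), R.arrows (homOfLE hT) →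
      ∃ (Y' : SaSa X S n d) (_ : T.1 ≤ Y'.1) (h' : Y' ≤ Y), res F.obj h' y = 0 := by
  let η := toSheafify (saTopTopology n X S) (preInverseImage F)
  refine ⟨_, Presheaf.equalizerSieve_mem (saTopTopology n X S) η (X := op Z)
    (toPreInverseImage F h y) 0 (hy.trans (map_zero (η.app (op Z)).hom).symm), fun T hT hR => ?_⟩
  exact exists_res_eq_zero_of_toPreInverseImage_eq_zero <|
    (res_toPreInverseImage F h hT y).symm.trans (hR.trans (map_zero (res (preInverseImage F) hT)))

end PullbackSection

section InnerLift

variable {n d : ℕ} {X : Type u} {S : Type v} [TopologicalSpace X] [TopologicalSpace S]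
  [ChartedSpace (EuclideanSpace ℝ (Fin n)) X] [ChartedSpace (EuclideanSpace ℝ (Fin d)) S]
  [T2Space X] [T2Space S] [IsManifold (𝓡 n) ω X] [IsManifold (𝓡 d) ω S]

/-- A section `y` of `F` on `Y` is an inner lift of a section `α` of `a⁻¹F` on `W` if, on every
object of `X_sa × S_sa` in `Y` that is fibrewise inner in some `Z ⊆ W`, it agrees with every section
of `F` inducing `α` on `Z`. -/
def IsInnerLift (F : SaSaSheaf n d X S) {W : SaTop X S n} (α : (inverseImage F).obj.obj (op W))
    {Y : SaSa X S n d} (y : F.obj.obj (op Y)) : Prop :=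
  ∀ ⦃Z : SaTop X S n⦄ (hZ : Z ≤ W) ⦃M : SaSa X S n d⦄ (hM : Z.1 ≤ M.1) (m : F.obj.obj (op M)),
    pullbackSection F hM m = res (inverseImage F).obj hZ α →
    ∀ ⦃T : SaSa X S n d⦄ (hT : T ≤ Y) (hTZ : IsFiberwiseInner (T.1 : Set (X × S)) Z.1),
      res F.obj hT y = res F.obj (show T ≤ M from hTZ.subset.trans hM) m

variable {F : SaSaSheaf n d X S} {W Z : SaTop X S n} {Y : SaSa X S n d}

theorem IsInnerLift.res {α : (inverseImage F).obj.obj (op W)} {y : F.obj.obj (op Y)}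
    (hy : IsInnerLift F α y) {Y' : SaSa X S n d} (h : Y' ≤ Y) :
    IsInnerLift F α (RelSub.res F.obj h y) := by
  intro Z hZ M hM m hm T hT hTZ
  rw [res_res]
  exact hy hZ hM m hm _ hTZ

variable [SecondCountableTopology X] [SecondCountableTopology S]

theorem res_eq_zero_of_pullbackSection_eq_zero {h : Z.1 ≤ Y.1} {y : F.obj.obj (op Y)}
    (hy : pullbackSection F h y = 0) {T : SaSa X S n d} (hT : T ≤ Y)
    (hTZ : IsFiberwiseInner (T.1 : Set (X × S)) Z.1) : res F.obj hT y = 0 := by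
  obtain ⟨R, hR, hRy⟩ := exists_sieve_res_eq_zero hy
  obtain ⟨R', hR', hR'R⟩ := exists_saSaTopology_isFiberwiseInner hR hTZ
  refine eq_of_res_eq F.property hR' fun T' hT' hRT' => ?_
  obtain ⟨Z', hZ', hRZ', hTZ'⟩ := hR'R T' hT' hRT'
  obtain ⟨Y', hZY', hY', hy'⟩ := hRy Z' hZ' hRZ'
  have hTY' : T' ≤ Y' := hTZ'.subset.trans hZY'
  rw [res_res, ← res_res F.obj hTY' hY', hy', map_zero, map_zero]

theorem res_eq_res_of_pullbackSection_eq {M M' : SaSa X S n d} {h : Z.1 ≤ M.1} {h' : Z.1 ≤ M'.1}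
    {m : F.obj.obj (op M)} {m' : F.obj.obj (op M')}
    (hm : pullbackSection F h m = pullbackSection F h' m') {T : SaSa X S n d} (hT : T ≤ M)
    (hT' : T ≤ M') (hTZ : IsFiberwiseInner (T.1 : Set (X × S)) Z.1) :
    res F.obj hT m = res F.obj hT' m' := by
  let N : SaSa X S n d := ⟨M.1 ⊓ M'.1, M.2.inf M'.2⟩
  have hN : N ≤ M := inf_le_left (b := M'.1)
  have hN' : N ≤ M' := inf_le_right (a := M.1)
  have hTN : T ≤ N := le_inf (show T.1 ≤ M.1 from hT) hT'
  have hdiff : pullbackSection F (le_inf h h' : Z.1 ≤ N.1)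
      (res F.obj hN m - res F.obj hN' m') = 0 := by
    rw [map_sub, pullbackSection_res, pullbackSection_res, hm, sub_self]
  have hzero := res_eq_zero_of_pullbackSection_eq_zero hdiff hTN hTZ
  rwa [map_sub, res_res, res_res, sub_eq_zero] at hzero

theorem exists_saSaTopology_pullbackSection_eq (α : (inverseImage F).obj.obj (op W))
    (hY : IsFiberwiseInner (Y.1 : Set (X × S)) W.1) :
    ∃ R ∈ saSaTopology n d X S Y, ∀ (T : SaSa X S n d) (hT : T ≤ Y), R.arrows (homOfLE hT) →
      ∃ (Z : SaTop X S n) (hZ : Z ≤ W) (M : SaSa X S n d) (hM : Z.1 ≤ M.1) (m : F.obj.obj (op M)),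
        pullbackSection F hM m = res (inverseImage F).obj hZ α ∧
          IsFiberwiseInner (T.1 : Set (X × S)) Z.1 := by
  obtain ⟨R, hR, hRα⟩ := exists_sieve_pullbackSection_eq F α
  obtain ⟨R', hR', hR'R⟩ := exists_saSaTopology_isFiberwiseInner hR hY
  refine ⟨R', hR', fun T hT hRT => ?_⟩
  obtain ⟨Z, hZ, hRZ, hTZ⟩ := hR'R T hT hRT
  obtain ⟨M, hM, m, hm⟩ := hRα Z hZ hRZ
  exact ⟨Z, hZ, M, hM, m, hm, hTZ⟩

theorem res_eq_res_of_pullbackSection_eq_res {α : (inverseImage F).obj.obj (op W)}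
    {Z Z' : SaTop X S n} {hZ : Z ≤ W} {hZ' : Z' ≤ W} {M M' : SaSa X S n d} {hM : Z.1 ≤ M.1}
    {hM' : Z'.1 ≤ M'.1} {m : F.obj.obj (op M)} {m' : F.obj.obj (op M')}
    (hm : pullbackSection F hM m = res (inverseImage F).obj hZ α)
    (hm' : pullbackSection F hM' m' = res (inverseImage F).obj hZ' α) {T : SaSa X S n d}
    (hT : T ≤ M) (hT' : T ≤ M') (hTZ : IsFiberwiseInner (T.1 : Set (X × S)) Z.1)
    (hTZ' : IsFiberwiseInner (T.1 : Set (X × S)) Z'.1) :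
    res F.obj hT m = res F.obj hT' m' := by
  let N : SaTop X S n := ⟨Z.1 ⊓ Z'.1, Z.2.inf Z'.2⟩
  have hN : N ≤ Z := inf_le_left (b := Z'.1)
  have hN' : N ≤ Z' := inf_le_right (a := Z.1)
  refine res_eq_res_of_pullbackSection_eq (h := Set.Subset.trans hN hM)
    (h' := Set.Subset.trans hN' hM') ?_ hT hT' (hTZ.inter hTZ')
  rw [← res_pullbackSection F hM hN, ← res_pullbackSection F hM' hN', hm, hm', res_res, res_res]

theorem IsInnerLift.unique {α : (inverseImage F).obj.obj (op W)} {y y' : F.obj.obj (op Y)}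
    (hy : IsInnerLift F α y) (hy' : IsInnerLift F α y')
    (hY : IsFiberwiseInner (Y.1 : Set (X × S)) W.1) : y = y' := by
  obtain ⟨R, hR, hRα⟩ := exists_saSaTopology_pullbackSection_eq α hY
  refine eq_of_res_eq F.property hR fun T hT hRT => ?_
  obtain ⟨Z, hZ, M, hM, m, hm, hTZ⟩ := hRα T hT hRT
  rw [hy hZ hM m hm hT hTZ, hy' hZ hM m hm hT hTZ]

theorem exists_isInnerLift (α : (inverseImage F).obj.obj (op W))
    (hY : IsFiberwiseInner (Y.1 : Set (X × S)) W.1) :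
    ∃ y : F.obj.obj (op Y), IsInnerLift F α y := by
  obtain ⟨R, hR, hRα⟩ := exists_saSaTopology_pullbackSection_eq α hY
  choose Z hZ M hM m hm hTZ using hRα
  have hTM : ∀ T hT hRT, T ≤ M T hT hRT := fun T hT hRT => (hTZ T hT hRT).subset.trans (hM T hT hRT)
  obtain ⟨y, hy⟩ := exists_res_eq F.property hR
    (fun T hT hRT => RelSub.res F.obj (hTM T hT hRT) (m T hT hRT)) <| by
      intro T T₁ T₂ hT₁ hT₂ hY₁ hY₂ hR₁ hR₂
      rw [res_res, res_res]
      exact res_eq_res_of_pullbackSection_eq_res (hm T₁ hY₁ hR₁) (hm T₂ hY₂ hR₂) _ _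
        ((hTZ T₁ hY₁ hR₁).mono hT₁ subset_rfl) ((hTZ T₂ hY₂ hR₂).mono hT₂ subset_rfl)
  refine ⟨y, fun Z' hZ' M' hM' m' hm' T hT hTZ' => ?_⟩
  refine eq_of_res_eq F.property ((saSaTopology n d X S).pullback_stable (homOfLE hT) hR)
    fun T' hT' hRT' => ?_
  have hRT' : R.arrows (homOfLE (hT'.trans hT)) := hRT'
  rw [res_res, res_res, hy T' (hT'.trans hT) hRT']
  exact res_eq_res_of_pullbackSection_eq_res (hm T' _ hRT') hm' _ _ (hTZ T' _ hRT')
    (hTZ'.mono hT' subset_rfl)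

theorem IsInnerLift.pullbackSection_eq {α : (inverseImage F).obj.obj (op W)}
    {y : F.obj.obj (op Y)} (hy : IsInnerLift F α y)
    (hY : IsFiberwiseInner (Y.1 : Set (X × S)) W.1) (hZW : Z ≤ W) (hZY : Z.1 ≤ Y.1) :
    pullbackSection F hZY y = RelSub.res (inverseImage F).obj hZW α := by
  obtain ⟨R, hR, hRα⟩ := exists_saSaTopology_pullbackSection_eq α hY
  obtain ⟨R', hR', hR'R⟩ := exists_saTopTopology_of_saSaTopology hR hZY
  refine eq_of_res_eq (inverseImage F).property hR' fun T hT hRT => ?_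
  obtain ⟨T', hT', hRT', hTT'⟩ := hR'R T hT hRT
  obtain ⟨Z', hZ', M, hM, m, hm, hTZ'⟩ := hRα T' hT' hRT'
  have hTZ : T ≤ Z' := Set.Subset.trans hTT' hTZ'.subset
  rw [res_pullbackSection, ← pullbackSection_res F hTT' hT', hy hZ' hM m hm hT' hTZ',
    pullbackSection_res, ← res_pullbackSection F hM hTZ, hm, res_res, res_res]

end InnerLift

section Main

variable {n d : ℕ} {X : Type u} {S : Type v} [TopologicalSpace X] [TopologicalSpace S]
  [ChartedSpace (EuclideanSpace ℝ (Fin n)) X] [ChartedSpace (EuclideanSpace ℝ (Fin d)) S]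
  [T2Space X] [T2Space S] [IsManifold (𝓡 n) ω X] [IsManifold (𝓡 d) ω S]
  [SecondCountableTopology X] [SecondCountableTopology S] {F : SaSaSheaf n d X S} {W : SaTop X S n}
  {ι : Type*} {f : ι → SaSa X S n d}

theorem eq_zero_of_forall_pullbackSection_eq_zero [Preorder ι] (hf : Monotone f)
    (hrel : ∀ i, IsRelSubanalytic X S n (f i).1)
    (hinn : ∀ i, IsFiberwiseInner ((f i).1 : Set (X × S)) W.1)
    (hinf : ∀ i j, ∃ k, k ≤ i ∧ k ≤ j ∧ (f i).1 ⊓ (f j).1 ≤ (f k).1)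
    (hcov : Sieve.ofObjects (fun i => (⟨(f i).1, hrel i⟩ : SaTop X S n)) W ∈
      saTopTopology n X S W)
    {y : ∀ i, F.obj.obj (op (f i))} (hy : ∀ i j (h : i ≤ j), res F.obj (hf h) (y j) = y i)
    (hy₀ : ∀ i, pullbackSection F (Z := ⟨(f i).1, hrel i⟩) le_rfl (y i) = 0) (i : ι) :
    y i = 0 := by
  obtain ⟨R, hR, hRf⟩ := exists_saSaTopology_isFiberwiseInner hcov (hinn i)
  refine eq_of_res_eq F.property hR fun T hTi hRT => ?_
  obtain ⟨Z, -, ⟨j, ⟨g⟩⟩, hTZ⟩ := hRf T hTi hRT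
  have hTj : IsFiberwiseInner (T.1 : Set (X × S)) (f j).1 := hTZ.mono subset_rfl (leOfHom g)
  obtain ⟨k, hki, hkj, hk⟩ := hinf i j
  have hTk : T ≤ f k := (le_inf (show T.1 ≤ (f i).1 from hTi) hTj.subset).trans hk
  calc res F.obj hTi (y i) = res F.obj hTk (y k) := by rw [← hy k i hki, res_res]
    _ = res F.obj (show T ≤ f j from hTj.subset) (y j) := by rw [← hy k j hkj, res_res]
    _ = 0 := res_eq_zero_of_pullbackSection_eq_zero (hy₀ j) _ hTj
    _ = res F.obj hTi 0 := (map_zero _).symm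

theorem exists_isInnerLift_family [Preorder ι] (hf : Monotone f)
    (hinn : ∀ i, IsFiberwiseInner ((f i).1 : Set (X × S)) W.1)
    (α : (inverseImage F).obj.obj (op W)) :
    ∃ y : ∀ i, F.obj.obj (op (f i)), (∀ i, IsInnerLift F α (y i)) ∧
      ∀ i j (h : i ≤ j), res F.obj (hf h) (y j) = y i := by
  choose y hy using fun i => exists_isInnerLift α (hinn i)
  exact ⟨y, hy, fun i j h => ((hy j).res (hf h)).unique (hy i) (hinn i)⟩

variable (F) in
theorem exists_limit_iso_of_isFiberwiseInner [Preorder ι] (hf : Monotone f)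
    (hrel : ∀ i, IsRelSubanalytic X S n (f i).1)
    (hinn : ∀ i, IsFiberwiseInner ((f i).1 : Set (X × S)) W.1)
    (hinf : ∀ i j, ∃ k, k ≤ i ∧ k ≤ j ∧ (f i).1 ⊓ (f j).1 ≤ (f k).1)
    (hcov : Sieve.ofObjects (fun i => (⟨(f i).1, hrel i⟩ : SaTop X S n)) W ∈
      saTopTopology n X S W)
    [HasLimit (hf.functor.op ⋙ F.obj)]
    [PreservesLimit (hf.functor.op ⋙ F.obj) (forget (ModuleCat.{max u v} ℂ))] :
    ∃ e : limit (hf.functor.op ⋙ F.obj) ≅ (inverseImage F).obj.obj (op W),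
      ∀ i, e.hom ≫ (inverseImage F).obj.map
          (homOfLE (show (⟨(f i).1, hrel i⟩ : SaTop X S n) ≤ W from (hinn i).subset)).op =
        limit.π (hf.functor.op ⋙ F.obj) (op i) ≫ toInverseImage F (f i).1 (f i).2 (hrel i) := by
  let π (i : ι) : (limit (hf.functor.op ⋙ F.obj) : ModuleCat.{max u v} ℂ) →ₗ[ℂ]
    F.obj.obj (op (f i)) := (limit.π (hf.functor.op ⋙ F.obj) (op i)).hom
  have hπ : ∀ x i j (h : i ≤ j), res F.obj (hf h) (π j x) = π i x := fun x i j h =>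
    congr($(limit.w (hf.functor.op ⋙ F.obj) (homOfLE h).op).hom x)
  refine exists_limit_iso (K := hf.functor.op ⋙ F.obj) (inverseImage F).property
    (fun i => (hinn i).subset) hcov (fun i => toInverseImage F (f i).1 (f i).2 (hrel i)) ?_ ?_ ?_
  · intro x i j T hi hj
    obtain ⟨k, hki, hkj, hk⟩ := hinf i j
    have hTk : T.1 ≤ (f k).1 := (le_inf (show T.1 ≤ (f i).1 from hi) hj).trans hk
    have hres : ∀ l (hl : T ≤ ⟨(f l).1, hrel l⟩), k ≤ l → res (inverseImage F).obj hl
        ((toInverseImage F (f l).1 (f l).2 (hrel l)).hom (π l x)) =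
          pullbackSection F hTk (π k x) := by
      intro l hl hkl
      rw [toInverseImage_apply, ← hπ x k l hkl, pullbackSection_res]
      exact res_pullbackSection F (Z := ⟨(f l).1, hrel l⟩) le_rfl hl (π l x)
    exact (hres i hi hki).trans (hres j hj hkj).symm
  · exact fun x hx => eq_zero_of_forall_pullbackSection_eq_zero hf hrel hinn hinf hcov (hπ x)
      fun i => (toInverseImage_apply F _ (f i).2 (hrel i) _).symm.trans (hx i)
  · intro α
    obtain ⟨y, hyα, hy⟩ := exists_isInnerLift_family hf hinn α
    exact ⟨y, hy, fun i => (toInverseImage_apply F _ (f i).2 (hrel i) _).trans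
      ((hyα i).pullbackSection_eq (hinn i) (hinn i).subset le_rfl)⟩

variable (F)

theorem exists_limit_rectSystem_iso (U : Opens X) (hU : IsSubanalytic n (U : Set X))
    (V : Opens S) :
    ∃ e : limit (rectSystem F U hU V) ≅ (inverseImage F).obj.obj (op (SaTop.rect U hU V)),
      ∀ V' : RelCompactSubanalytic d V,
        e.hom ≫ (inverseImage F).obj.map (homOfLE
            (Set.prod_mono_right (subset_closure.trans V'.2.2.2) :
              SaTop.rect U hU V'.1 ≤ SaTop.rect U hU V)).op =
          limit.π (rectSystem F U hU V) (op V') ≫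
            toInverseImage F (rect U V'.1) (SaSa.rect U hU V'.1 V'.2.1 V'.2.2.1).2
              (SaTop.rect U hU V'.1).2 := by
  refine exists_limit_iso_of_isFiberwiseInner F (W := SaTop.rect U hU V)
    (f := fun V' : RelCompactSubanalytic d V => SaSa.rect U hU V'.1 V'.2.1 V'.2.2.1)
    (fun _ _ h => Set.prod_mono_right h) (fun V' => (SaTop.rect U hU V'.1).2)
    (fun V' => isFiberwiseInner_prod (Set.prod_mono_right V'.2.2.2)) (fun V' V'' => ?_)
    (ofObjects_mem_saTopTopology
      (fun V' => Set.prod_mono_right (subset_closure.trans V'.2.2.2)) fun U' _ _ s hUs => ?_)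
  · exact ⟨⟨V'.1 ⊓ V''.1, V'.2.1.inter V''.2.1, V'.2.2.1.closure_of_subset
      (Set.inter_subset_left.trans subset_closure),
      (closure_mono Set.inter_subset_left).trans V'.2.2.2⟩, inf_le_left (b := V''.1),
      inf_le_right (a := V'.1), fun _ hp => ⟨hp.1.1, hp.1.2, hp.2.2⟩⟩
  · obtain hU' | ⟨x, hx⟩ := (U' : Set X).eq_empty_or_nonempty
    · exact ⟨∅, Set.finite_empty, by simp [hU']⟩
    · have hs : s ∈ V := (hUs (show (x, s) ∈ _ from ⟨hx, rfl⟩)).2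
      obtain ⟨M, hsM, hM, hMV⟩ := exists_subanalytic_closure_subset (d := d) hs
      refine ⟨{⟨M, hM.1, hM.2, hMV⟩}, Set.finite_singleton _, ?_⟩
      rintro ⟨x', _⟩ ⟨hx', rfl⟩
      exact Set.mem_iUnion₂.2 ⟨_, rfl, (hUs ⟨hx', rfl⟩).1, hsM⟩

variable (W)

theorem exists_limit_wqcSystem_iso :
    ∃ e : limit (wqcSystem F W) ≅ (inverseImage F).obj.obj (op W),
      ∀ W' : WeaklyQuasiCompactIn d W,
        e.hom ≫ (inverseImage F).obj.map (homOfLE W'.2.2.choose).op =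
          limit.π (wqcSystem F W) (op W') ≫ toInverseImage F W'.1.1 W'.2.1 W'.1.2 := by
  have : LocallyCompactSpace S := ChartedSpace.locallyCompactSpace (EuclideanSpace ℝ (Fin d)) S
  refine exists_limit_iso_of_isFiberwiseInner F
    (f := fun W' : WeaklyQuasiCompactIn d W => ⟨W'.1.1, W'.2.1⟩) (fun _ _ h => h)
    (fun W' => W'.1.2) (fun W' => W'.2.2.choose_spec.isFiberwiseInner) (fun W' W'' => ?_)
    (ofObjects_mem_saTopTopology (fun W' => W'.2.2.choose) fun U hU hUc s hUs => ?_)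
  · have hle : (⟨W'.1.1 ⊓ W''.1.1, W'.1.2.inf W''.1.2⟩ : SaTop X S n) ≤ W'.1 :=
      inf_le_left (b := W''.1.1)
    exact ⟨⟨⟨W'.1.1 ⊓ W''.1.1, W'.1.2.inf W''.1.2⟩, W'.2.1.inf W''.2.1, _,
      W'.2.2.choose_spec.of_le hle⟩, hle, inf_le_right (a := W'.1.1), le_rfl⟩
  · obtain ⟨Q, hQ, hUQ, hQW⟩ := exists_basicRect_isFiberwiseInner d hU hUc hUs
    let Q' : WeaklyQuasiCompactIn d W := ⟨⟨Q, isRelSubanalytic_of_mem_basicRects hQ⟩,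
      isBisubanalytic_of_mem hQ, hQW.subset, isWeaklyQuasiCompact_of_mem_basicRects hQ hQW _⟩
    exact ⟨{Q'}, Set.finite_singleton _, fun p hp => Set.mem_iUnion₂.2 ⟨Q', rfl, hUQ hp⟩⟩

end Main

end RelSub

theorem mainTheorem5 {n d : ℕ} (X : Type u) (S : Type v)
    [TopologicalSpace X] [T2Space X] [SecondCountableTopology X]
    [ChartedSpace (EuclideanSpace ℝ (Fin n)) X] [IsManifold (𝓡 n) ω X]
    [TopologicalSpace S] [T2Space S] [SecondCountableTopology S]
    [ChartedSpace (EuclideanSpace ℝ (Fin d)) S] [IsManifold (𝓡 d) ω S]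
    (F : RelSub.SaSaSheaf n d X S) :
    (∀ (U : Opens X) (hU : RelSub.IsSubanalytic n (U : Set X)) (V : Opens S),
      ∃ e : limit (RelSub.rectSystem F U hU V) ≅
          (RelSub.inverseImage F).obj.obj (op (RelSub.SaTop.rect U hU V)),
        ∀ V' : RelSub.RelCompactSubanalytic d V,
          e.hom ≫ (RelSub.inverseImage F).obj.map (homOfLE
              (Set.prod_mono_right (subset_closure.trans V'.2.2.2) :
                RelSub.SaTop.rect U hU V'.1 ≤ RelSub.SaTop.rect U hU V)).op =
            limit.π (RelSub.rectSystem F U hU V) (op V') ≫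
              RelSub.toInverseImage F (RelSub.rect U V'.1)
                (RelSub.SaSa.rect U hU V'.1 V'.2.1 V'.2.2.1).2
                (RelSub.SaTop.rect U hU V'.1).2) ∧
    (∀ W : RelSub.SaTop X S n,
      ∃ e : limit (RelSub.wqcSystem F W) ≅ (RelSub.inverseImage F).obj.obj (op W),
        ∀ W' : RelSub.WeaklyQuasiCompactIn d W,
          e.hom ≫ (RelSub.inverseImage F).obj.map (homOfLE W'.2.2.choose).op =
            limit.π (RelSub.wqcSystem F W) (op W') ≫
              RelSub.toInverseImage F W'.1.1 W'.2.1 W'.1.2) := by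
  exact ⟨RelSub.exists_limit_rectSystem_iso F, RelSub.exists_limit_wqcSystem_iso F⟩
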